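/- Let $S$ be a closed (compact, connected, without boundary) topological surface, $p:\tilde S\to S$ its universal covering and $\Gamma\cong\pi_1(S)$ the group of deck transformations. Let $X$ be a complete $\mathrm{CAT}(-1)$ space, $\rho:\Gamma\to\mathrm{Isom}(X)$ a representation, $\mathcal T=(V,E,F)$ a finite triangulation of $S$ (sides or vertices of one face may be glued together, so a single vertex is allowed), $\tilde{\mathcal T}=(\tilde V,\tilde E,\tilde F)$ its lift to $\tilde S$, and $F:\tilde V\to X$ a $\rho$-equivariant map. Put $\ell_F(e)=|F(e_-)F(e_+)|_X$ for $e\in\tilde E$; this is $\Gamma$-invariant and induces a length function $\ell_F$ on $E$. For each face $f$ let $\Delta_f\subset\mathbb H^2$ be the (possibly flat) hyperbolic triangle whose side lengths are the $\ell_F$-lengths of the sides of $f$. Let $C_F$ be the metric space obtained by gluing the triangles $\Delta_f$, $f$ a face of $\mathcal T$, isometrically along their common sides following the combinatorics of $\mathcal T$ (with the gluing pseudo-metric, i.e. the infimum of lengths of chains, and points at distance $0$ identified). Let $\tilde C_F$ be the space obtained in the same way from the faces of $\tilde{\mathcal T}$. Deck transformations permute the triangles of $\tilde C_F$; let $\rho_F:\Gamma\to\mathrm{Isom}(\tilde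 C_F)$ be the resulting representation. Then: 1. $\rho_F$ dominates $\rho$: there is a $1$-Lipschitz map $f:\tilde C_F\to X$ with $f(\rho_F(\gamma)y)=\rho(\gamma)f(y)$ for all $\gamma\in\Gamma$, $y\in\tilde C_F$. Moreover $f$ can be chosen to extend $F$ and to restrict, on the sides of each triangle $\Delta_f$, to the comparison map, which sends each side of $\Delta_f$ isometrically onto the geodesic segment of $X$ joining the images under $F$ of the corresponding vertices. 2. $\tilde C_F$ is the structure over $C_F$ on which $\Gamma$ acts: distances in $\tilde C_F$ are finite, and there are continuous surjections $p_{\mathcal T}:S\to C_F$ and $\tilde p_{\mathcal T}:\tilde S\to\tilde C_F$, carrying each face onto the corresponding triangle and respecting sides and vertices, and a map $\pi:\tilde C_F\to C_F$ which sends each triangle of $\tilde C_F$ identically to the corresponding triangle of $C_F$, such that $\pi\circ\tilde p_{\mathcal T}=p_{\mathcal T}\circ p$, $\tilde p_{\mathcal T}\circ\gamma=\rho_F(\gamma)\circ\tilde p_{\mathcal T}$ for all $\gamma\in\Gamma$, and $|\pi(y)\,\pi(z)|=\inf_{\gamma\in\Gamma}|y\,\rho_F(\gamma)z|$ for all $y,z\in\tilde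 C_F$. If $\ell_F$ flattens no face (all triangle inequalities in the faces are strict), then $p_{\mathcal T}$ and $\tilde p_{\mathcal T}$ are homeomorphisms, $\tilde C_F$ is simply connected, and $\pi$ is a covering map and a local isometry; so $\tilde C_F$ is the universal cover of $C_F$ and $\rho_F$ is the action of $\pi_1(S)\cong\pi_1(C_F)$ by deck transformations. -/

import Mathlib

open scoped UpperHalfPlane ENNReal

noncomputable section

universe u v w

/-! ### Geodesics, triangles in the hyperbolic plane, `CAT(-1)` spaces

The hyperbolic plane is Mathlib's upper half-plane `ℍ` with its metric of curvature `-1`. -/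

/-- `c` restricted to `[0, |xy|]` is a geodesic from `x` to `y`. -/
structure IsGeodesicFromTo {X : Type v} [MetricSpace X] (c : ℝ → X) (x y : X) : Prop where
  source : c 0 = x
  target : c (dist x y) = y
  isometric : ∀ s ∈ Set.Icc 0 (dist x y), ∀ t ∈ Set.Icc 0 (dist x y),
    dist (c s) (c t) = |s - t|

/-- The geodesic segment `[ab]` in the hyperbolic plane. -/
def hypSegment (a b : ℍ) : Set ℍ := {z | dist a z + dist z b = dist a b}

/-- The (full) hyperbolic triangle with vertices `a 0, a 1, a 2`, that is the convex hull of the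
three points: the union of the segments joining `a 0` to the points of `[a 1, a 2]`. -/
def hypTriangle (a : Fin 3 → ℍ) : Set ℍ :=
  {z | ∃ q ∈ hypSegment (a 1) (a 2), z ∈ hypSegment (a 0) q}

/-- `CAT(-1)` spaces: geodesic spaces whose geodesic triangles are no thicker than their comparison
triangles in `ℍ`. In the triangle with vertices `x, y, z`, the two points `c s` and `c' t` lie on
the sides `[xy]` and `[xz]`, and `p'`, `q'` are their comparison points. (Pairs of points on the
other pairs of sides are obtained by permuting `x, y, z`; for two points of the same side the
inequality is an equality.) -/
structure IsCATNegOne (X : Type v) [MetricSpace X] : Prop where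
  geodesic : ∀ x y : X, ∃ c : ℝ → X, IsGeodesicFromTo c x y
  comparison : ∀ (x y z : X) (c c' : ℝ → X),
    IsGeodesicFromTo c x y → IsGeodesicFromTo c' x z →
    ∀ x' y' z' : ℍ, dist x' y' = dist x y → dist x' z' = dist x z → dist y' z' = dist y z →
    ∀ s ∈ Set.Icc 0 (dist x y), ∀ t ∈ Set.Icc 0 (dist x z),
    ∀ p' ∈ hypSegment x' y', ∀ q' ∈ hypSegment x' z', dist x' p' = s → dist x' q' = t →
      dist (c s) (c' t) ≤ dist p' q'

/-- A hyperbolic triangle (given by its vertices) with prescribed side lengths. -/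
def triangleOfLengths (ℓ : Fin 3 → Fin 3 → ℝ) : Fin 3 → ℍ :=
  Classical.epsilon fun a => ∀ i j, dist (a i) (a j) = ℓ i j

/-! ### Dominations -/

/-- A domination of `ρ₂` by `ρ₁`: a `1`-Lipschitz `(ρ₁, ρ₂)`-equivariant map. -/
def IsDomination {Γ : Type u} [Group Γ] {X₁ : Type v} {X₂ : Type w} [PseudoEMetricSpace X₁]
    [PseudoEMetricSpace X₂] (ρ₁ : Γ →* (X₁ ≃ᵢ X₁)) (ρ₂ : Γ →* (X₂ ≃ᵢ X₂)) (f : X₁ → X₂) : Prop :=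
  LipschitzWith 1 f ∧ ∀ γ x, f (ρ₁ γ x) = ρ₂ γ (f x)

/-! ### Triangulations

The sides of a triangle may be glued to each other and a triangulation may have a single vertex. -/

/-- The side of the singular triangle `f` from its `i`-th to its `j`-th vertex, as a
parametrized edge (constant if `i = j`). -/
def side {S : Type u} [TopologicalSpace S] (f : C(stdSimplex ℝ (Fin 3), S)) (i j : Fin 3) :
    C(stdSimplex ℝ (Fin 2), S) :=
  f.comp ⟨stdSimplex.map ![i, j], stdSimplex.continuous_map _⟩

/-- A (finite) triangulation `(V, E, F)` of `S`: edges and faces are given by characteristic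
maps, every side of a face is an edge up to reversal, the open cells are embedded and pairwise
disjoint, and the faces cover `S`. -/
structure Triangulation (S : Type u) [TopologicalSpace S] where
  V : Set S
  E : Set C(stdSimplex ℝ (Fin 2), S)
  F : Set C(stdSimplex ℝ (Fin 3), S)
  finite_F : F.Finite
  endpoint_mem : ∀ e ∈ E, ∀ i, e (stdSimplex.vertex i) ∈ V
  side_mem : ∀ f ∈ F, ∀ i j, i ≠ j → side f i j ∈ E ∨ side f j i ∈ E
  cover : ∀ x, ∃ f ∈ F, ∃ t, f t = x
  edge_inj : ∀ e ∈ E, ∀ e' ∈ E, ∀ s s', (∀ k, 0 < s k) → (∀ k, 0 < s' k) →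
    e s = e' s' → e = e' ∧ s = s'
  face_inj : ∀ f ∈ F, ∀ f' ∈ F, ∀ t t', (∀ k, 0 < t k) → (∀ k, 0 < t' k) →
    f t = f' t' → f = f' ∧ t = t'
  vertex_ne_edge : ∀ e ∈ E, ∀ s, (∀ k, 0 < s k) → e s ∉ V
  vertex_ne_face : ∀ f ∈ F, ∀ t, (∀ k, 0 < t k) → f t ∉ V
  edge_ne_face : ∀ e ∈ E, ∀ f ∈ F, ∀ s t, (∀ k, 0 < s k) → (∀ k, 0 < t k) → e s ≠ f t

theorem Triangulation.vertex_mem {S : Type u} [TopologicalSpace S] (T : Triangulation S)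
    {f : C(stdSimplex ℝ (Fin 3), S)} (hf : f ∈ T.F) (i : Fin 3) :
    f (stdSimplex.vertex i) ∈ T.V := by
  have key : ∀ (k l : Fin 3) (m : Fin 2),
      side f k l (stdSimplex.vertex m) = f (stdSimplex.vertex (![k, l] m)) := by
    intro k l m
    simp [side, stdSimplex.map_vertex]
  rcases T.side_mem f hf i (i + 1) (by fin_cases i <;> decide) with h | h
  · have := T.endpoint_mem _ h 0
    rwa [key] at this
  · have := T.endpoint_mem _ h 1
    rwa [key] at this

/-! ### Conical hyperbolic structures

`𝓕` is a set of (characteristic maps of) faces, and `ℓ f i j` is the length of the side of `f`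
joining its `i`-th and `j`-th vertices. -/

section Cone

variable {S : Type u} [TopologicalSpace S] (𝓕 : Set C(stdSimplex ℝ (Fin 3), S))
  (ℓ : 𝓕 → Fin 3 → Fin 3 → ℝ)

/-- The disjoint union of the hyperbolic triangles `Δ_f`, for `f` a face. -/
structure FacePoint where
  face : 𝓕
  pt : ℍ
  mem : pt ∈ hypTriangle (triangleOfLengths (ℓ face))

variable {𝓕 ℓ}

/-- The point `x` of `Δ_f` lies on the side of `Δ_f` joining the vertices `i` and `j`. -/
def FacePoint.OnSide (x : FacePoint 𝓕 ℓ) (i j : Fin 3) : Prop :=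
  x.pt ∈ hypSegment (triangleOfLengths (ℓ x.face) i) (triangleOfLengths (ℓ x.face) j)

/-- Two points are glued if they correspond to each other on a common side (for `i = j` and
`k = l`: a common vertex) of two faces. -/
def Glued (x y : FacePoint 𝓕 ℓ) : Prop :=
  ∃ i j k l, side x.face.1 i j = side y.face.1 k l ∧ x.OnSide i j ∧ y.OnSide k l ∧
    dist (triangleOfLengths (ℓ x.face) i) x.pt = dist (triangleOfLengths (ℓ y.face) k) y.pt

/-- `Chain x y L`: there is a chain of total length `L` from `x` to `y`, each step of which
either moves inside a triangle or jumps for free between glued points. -/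
inductive Chain (x : FacePoint 𝓕 ℓ) : FacePoint 𝓕 ℓ → ℝ≥0∞ → Prop
  | refl : Chain x x 0
  | move {y z : FacePoint 𝓕 ℓ} {L : ℝ≥0∞} : Chain x y L → y.face = z.face →
      Chain x z (L + edist y.pt z.pt)
  | glue {y z : FacePoint 𝓕 ℓ} {L : ℝ≥0∞} : Chain x y L → Glued y z → Chain x z L

theorem Glued.symm {x y : FacePoint 𝓕 ℓ} (h : Glued x y) : Glued y x := by
  obtain ⟨i, j, k, l, h1, h2, h3, h4⟩ := h
  exact ⟨k, l, i, j, h1.symm, h3, h2, h4.symm⟩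

theorem Chain.trans {x y z : FacePoint 𝓕 ℓ} {L M : ℝ≥0∞} (h : Chain x y L) (h' : Chain y z M) :
    Chain x z (L + M) := by
  induction h' with
  | refl => simpa using h
  | move _ hf ih => rw [← add_assoc]; exact ih.move hf
  | glue _ hg ih => exact ih.glue hg

theorem Chain.symm {x y : FacePoint 𝓕 ℓ} {L : ℝ≥0∞} (h : Chain x y L) : Chain y x L := by
  induction h with
  | refl => exact Chain.refl
  | @move y z L _ hf ih =>
    have h1 : Chain z y (0 + edist z.pt y.pt) := Chain.refl.move hf.symm
    have := h1.trans ih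
    rwa [zero_add, edist_comm, add_comm] at this
  | glue _ hg ih =>
    have := (Chain.refl.glue hg.symm).trans ih
    rwa [zero_add] at this

/-- The gluing pseudo-metric: the infimum of the lengths of chains. -/
instance : PseudoEMetricSpace (FacePoint 𝓕 ℓ) where
  edist x y := sInf {L | Chain x y L}
  edist_self x := le_antisymm (sInf_le Chain.refl) zero_le
  edist_comm x y := by
    have : {L | Chain x y L} = {L | Chain y x L} :=
      Set.ext fun L => ⟨fun h => Chain.symm h, fun h => Chain.symm h⟩
    change sInf {L | Chain x y L} = sInf {L | Chain y x L}
    rw [this]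
  edist_triangle x y z := by
    change sInf {L | Chain x z L} ≤ sInf {L | Chain x y L} + sInf {L | Chain y z L}
    rw [ENNReal.sInf_add]
    refine le_iInf₂ fun L hL => ?_
    rw [add_comm, ENNReal.sInf_add]
    refine le_iInf₂ fun M hM => ?_
    rw [add_comm]
    exact sInf_le (Chain.trans hL hM)

variable (𝓕 ℓ)

/-- The conical hyperbolic structure: the metric space obtained by gluing the hyperbolic
triangles `Δ_f` along their common sides. -/
abbrev Cone := SeparationQuotient (FacePoint 𝓕 ℓ)

variable {𝓕 ℓ}

/-- The point of the glued space given by a point of one of the triangles. -/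
def Cone.mk (x : FacePoint 𝓕 ℓ) : Cone 𝓕 ℓ := SeparationQuotient.mk x

/-- No face is flattened: all triangle inequalities between the sides of a face are strict. -/
def NonDegenerate (ℓ : 𝓕 → Fin 3 → Fin 3 → ℝ) : Prop :=
  ∀ f i j k, i ≠ j → j ≠ k → i ≠ k → ℓ f i j < ℓ f i k + ℓ f k j

/-- `P` carries each face `f` onto the triangle `Δ_f`, respecting sides and (case `i = j`)
vertices. -/
def RespectsFaces (P : S → Cone 𝓕 ℓ) : Prop :=
  ∀ f : 𝓕, P '' Set.range f.1 = {c | ∃ x : FacePoint 𝓕 ℓ, x.face = f ∧ Cone.mk x = c} ∧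
    ∀ i j, P '' Set.range (side f.1 i j) =
      {c | ∃ x : FacePoint 𝓕 ℓ, x.face = f ∧ x.OnSide i j ∧ Cone.mk x = c}

theorem edist_map_le {S' : Type v} [TopologicalSpace S'] {𝓕' : Set C(stdSimplex ℝ (Fin 3), S')}
    {ℓ' : 𝓕' → Fin 3 → Fin 3 → ℝ} (φ : FacePoint 𝓕 ℓ → FacePoint 𝓕' ℓ')
    (hpt : ∀ x, (φ x).pt = x.pt) (hface : ∀ x y, x.face = y.face → (φ x).face = (φ y).face)
    (hglue : ∀ x y, Glued x y → Glued (φ x) (φ y)) (x y : FacePoint 𝓕 ℓ) :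
    edist (φ x) (φ y) ≤ edist x y := by
  change sInf {L | Chain (φ x) (φ y) L} ≤ sInf {L | Chain x y L}
  refine le_sInf fun L (hL : Chain x y L) => sInf_le ?_
  change Chain (φ x) (φ y) L
  induction hL with
  | refl => exact Chain.refl
  | move _ hf ih =>
    have := ih.move (hface _ _ hf)
    rwa [hpt, hpt] at this
  | glue _ hg ih => exact ih.glue (hglue _ _ hg)

end Cone

/-! ### Equivariant maps and the associated representation -/

section Equivariant

variable {S : Type u} {S' : Type v} [TopologicalSpace S] [TopologicalSpace S']

/-- The group `Γ` of deck transformations of `p : S' → S`. When `p` is the universal covering it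
is the fundamental group of `S`. -/
def deckGroup (p : C(S', S)) : Subgroup (S' ≃ₜ S') where
  carrier := {γ | ∀ s, p (γ s) = p s}
  mul_mem' := fun {a b} ha hb s => by
    change p (a (b s)) = p s
    rw [ha, hb]
  one_mem' := fun _ => rfl
  inv_mem' := fun {a} ha s => by
    have h := ha (a.symm s)
    rw [Homeomorph.apply_symm_apply] at h
    exact h.symm

variable (T : Triangulation S) (p : C(S', S))

/-- Vertices of the lifted triangulation. -/
def liftV : Set S' := p ⁻¹' T.V

/-- Faces of the lifted triangulation: all lifts of faces. -/
def liftF : Set C(stdSimplex ℝ (Fin 3), S') := {g | p.comp g ∈ T.F}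

variable {T p}

/-- The `i`-th vertex of a lifted face. -/
def liftVertex (g : liftF T p) (i : Fin 3) : liftV T p :=
  ⟨g.1 (stdSimplex.vertex i), T.vertex_mem g.2 i⟩

variable {X : Type w} [MetricSpace X]

/-- The length function `ℓ_F` on the lifted triangulation. -/
def upLength (F : liftV T p → X) (g : liftF T p) (i j : Fin 3) : ℝ :=
  dist (F (liftVertex g i)) (F (liftVertex g j))

open Classical in
/-- The length function `ℓ_F` induced on the triangulation of `S`: the value of `upLength` on any
lift of the face. -/
def downLength (F : liftV T p → X) (f : T.F) (i j : Fin 3) : ℝ :=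
  if h : ∃ g : liftF T p, p.comp g.1 = f.1 then upLength F h.choose i j else 0

/-- `F` is `ρ`-equivariant. -/
def IsEquivariant (ρ : deckGroup p →* (X ≃ᵢ X)) (F : liftV T p → X) : Prop :=
  ∀ (γ : deckGroup p) (x y : liftV T p), (y : S') = γ.1 x → F y = ρ γ (F x)

/-- Action of a deck transformation on the lifted faces. -/
def deckFace (γ : deckGroup p) (g : liftF T p) : liftF T p :=
  ⟨(γ.1 : C(S', S')).comp g.1, by
    have h : p.comp ((γ.1 : C(S', S')).comp g.1) = p.comp g.1 :=
      ContinuousMap.ext fun t => γ.2 (g.1 t)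
    change _ ∈ T.F
    rw [h]
    exact g.2⟩

theorem upLength_deckFace {ρ : deckGroup p →* (X ≃ᵢ X)} {F : liftV T p → X}
    (hF : IsEquivariant ρ F) (γ : deckGroup p) (g : liftF T p) :
    upLength F (deckFace γ g) = upLength F g := by
  funext i j
  unfold upLength
  rw [hF γ (liftVertex g i) (liftVertex (deckFace γ g) i) rfl,
    hF γ (liftVertex g j) (liftVertex (deckFace γ g) j) rfl]
  exact (ρ γ).isometry.dist_eq _ _

/-- The structure `C_F` on `S`. -/
abbrev ConeF (F : liftV T p → X) := Cone T.F (downLength F)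

/-- The structure given by the lifted metric triangulation on the universal cover. -/
abbrev ConeFLift (F : liftV T p → X) := Cone (liftF T p) (upLength F)

/-- A deck transformation `γ` maps `Δ_g` identically onto `Δ_{γ g}`. -/
def deckPoint {ρ : deckGroup p →* (X ≃ᵢ X)} {F : liftV T p → X}
    (hF : IsEquivariant ρ F) (γ : deckGroup p) (x : FacePoint (liftF T p) (upLength F)) :
    FacePoint (liftF T p) (upLength F) :=
  ⟨deckFace γ x.face, x.pt, by rw [upLength_deckFace hF]; exact x.mem⟩

theorem edist_deckPoint_le {ρ : deckGroup p →* (X ≃ᵢ X)} {F : liftV T p → X}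
    (hF : IsEquivariant ρ F) (γ : deckGroup p) (x y : FacePoint (liftF T p) (upLength F)) :
    edist (deckPoint hF γ x) (deckPoint hF γ y) ≤ edist x y := by
  refine edist_map_le (deckPoint hF γ) (fun _ => rfl) (fun x y h => ?_) (fun x y h => ?_) x y
  · change deckFace γ x.face = deckFace γ y.face
    rw [h]
  · obtain ⟨i, j, k, l, h1, h2, h3, h4⟩ := h
    refine ⟨i, j, k, l, ?_, ?_, ?_, ?_⟩
    · change (γ.1 : C(S', S')).comp (side x.face.1 i j) = (γ.1 : C(S', S')).comp (side y.face.1 k l)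
      rw [h1]
    · unfold FacePoint.OnSide at *
      change x.pt ∈ hypSegment (triangleOfLengths (upLength F (deckFace γ x.face)) i)
        (triangleOfLengths (upLength F (deckFace γ x.face)) j)
      rwa [upLength_deckFace hF]
    · unfold FacePoint.OnSide at *
      change y.pt ∈ hypSegment (triangleOfLengths (upLength F (deckFace γ y.face)) k)
        (triangleOfLengths (upLength F (deckFace γ y.face)) l)
      rwa [upLength_deckFace hF]
    · change dist (triangleOfLengths (upLength F (deckFace γ x.face)) i) x.pt =
        dist (triangleOfLengths (upLength F (deckFace γ y.face)) k) y.pt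
      rwa [upLength_deckFace hF, upLength_deckFace hF]

/-- The induced map on the glued space. -/
def deckCone {ρ : deckGroup p →* (X ≃ᵢ X)} {F : liftV T p → X} (hF : IsEquivariant ρ F)
    (γ : deckGroup p) : ConeFLift F → ConeFLift F :=
  SeparationQuotient.lift (fun x => Cone.mk (deckPoint hF γ x)) fun x y h => by
    refine SeparationQuotient.mk_eq_mk.2 (EMetric.inseparable_iff.2 ?_)
    exact le_antisymm ((edist_deckPoint_le hF γ x y).trans_eq (EMetric.inseparable_iff.1 h))
      zero_le

theorem deckCone_mul {ρ : deckGroup p →* (X ≃ᵢ X)} {F : liftV T p → X} (hF : IsEquivariant ρ F)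
    (γ δ : deckGroup p) (c : ConeFLift F) :
    deckCone hF (γ * δ) c = deckCone hF γ (deckCone hF δ c) := by
  obtain ⟨c, rfl⟩ := SeparationQuotient.surjective_mk c
  rfl

theorem deckCone_one {ρ : deckGroup p →* (X ≃ᵢ X)} {F : liftV T p → X} (hF : IsEquivariant ρ F)
    (c : ConeFLift F) : deckCone hF 1 c = c := by
  obtain ⟨c, rfl⟩ := SeparationQuotient.surjective_mk c
  rfl

theorem edist_deckCone_le {ρ : deckGroup p →* (X ≃ᵢ X)} {F : liftV T p → X}
    (hF : IsEquivariant ρ F) (γ : deckGroup p) (c d : ConeFLift F) :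
    edist (deckCone hF γ c) (deckCone hF γ d) ≤ edist c d := by
  obtain ⟨c, rfl⟩ := SeparationQuotient.surjective_mk c
  obtain ⟨d, rfl⟩ := SeparationQuotient.surjective_mk d
  exact edist_deckPoint_le hF γ _ _

/-- The representation `ρ_F` associated with `C_F`: deck transformations permute the triangles of
the lifted structure, and so act on it by isometries. -/
def coneRep {ρ : deckGroup p →* (X ≃ᵢ X)} {F : liftV T p → X} (hF : IsEquivariant ρ F) :
    deckGroup p →* (ConeFLift F ≃ᵢ ConeFLift F) where
  toFun γ :=
    { toFun := deckCone hF γ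
      invFun := deckCone hF γ⁻¹
      left_inv := fun c => by rw [← deckCone_mul, inv_mul_cancel, deckCone_one]
      right_inv := fun c => by rw [← deckCone_mul, mul_inv_cancel, deckCone_one]
      isometry_toFun := fun c d => by
        refine le_antisymm (edist_deckCone_le hF γ c d) ?_
        have h := edist_deckCone_le hF γ⁻¹ (deckCone hF γ c) (deckCone hF γ d)
        rwa [← deckCone_mul, ← deckCone_mul, inv_mul_cancel, deckCone_one, deckCone_one] at h }
  map_one' := IsometryEquiv.ext fun c => deckCone_one hF c
  map_mul' γ δ := IsometryEquiv.ext fun c => deckCone_mul hF γ δ c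

end Equivariant

end

/-! Domination. By the `CAT(-1)` inequality the comparison map on the sides of a triangle is short,
and Kirszbraun's theorem extends it to a short map on `ℍ` (`IsCATNegOne.exists_comparison_map`).
Deck transformations act freely on the lifted faces, so one extension is chosen per face of `T` and
carried to the other lifts by `ρ`. On a common side two extensions follow the same geodesic by arc
length. They therefore agree at glued points and do not lengthen chains.

Kirszbraun. It suffices to add one point. For finitely many points and up to `ε`, Hahn-Banach
reduces the problem to one weighted inequality for `∑ λ_j cosh d(·, y_j)`. This follows by comparing
the first-order condition at a minimum in `X` with the reverse Cauchy-Schwarz inequality on the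
hyperboloid (`IsCATNegOne.exists_weighted_le`). Strong convexity of `cosh d` replaces compactness
when passing to `ε = 0` and to infinitely many points, and Zorn's lemma finishes.

Canonical maps. Normalizing linear combinations of hyperboloid vectors gives barycentric coordinates
on a triangle, flat or not. Distances in these coordinates depend only on the side lengths, so the
face parametrizations descend to a continuous map from the surface to the glued space. If no
triangle is flat, the coordinates are injective, and a chain of small length starting at `x` cannot
leave the star of `x` (`IsFaceSystem.exists_forall_edist_toCone_lt`). The canonical map is then
injective and open.

Projection. Faces and their adjacencies lift through `p`, hence so do chains, with the same length.
Two lifts of a face differ by a deck transformation, so the metric below is the infimum over orbits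
(`edist_projCone`). In the nondegenerate case the canonical maps conjugate `π` to `p`, and `π` is a
local isometry because nontrivial deck transformations move points near a given one by a definite
amount. -/

noncomputable section

/-! ### The hyperboloid model -/

/-- The point of the hyperboloid `ac - b² = 1` in `ℝ³` corresponding to a point of `ℍ`. -/
def hvec (z : ℍ) : ℝ × ℝ × ℝ := (1 / z.im, z.re / z.im, (z.re ^ 2 + z.im ^ 2) / z.im)

/-- The Minkowski form polarizing `ac - b²`. -/
def mink : (ℝ × ℝ × ℝ) →ₗ[ℝ] (ℝ × ℝ × ℝ) →ₗ[ℝ] ℝ :=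
  LinearMap.mk₂ ℝ (fun v w => (v.1 * w.2.2 + v.2.2 * w.1) / 2 - v.2.1 * w.2.1)
    (fun _ _ _ => by simp only [Prod.fst_add, Prod.snd_add]; ring)
    (fun _ _ _ => by simp only [Prod.smul_fst, Prod.smul_snd, smul_eq_mul]; ring)
    (fun _ _ _ => by simp only [Prod.fst_add, Prod.snd_add]; ring)
    (fun _ _ _ => by simp only [Prod.smul_fst, Prod.smul_snd, smul_eq_mul]; ring)

theorem mink_apply (v w : ℝ × ℝ × ℝ) :
    mink v w = (v.1 * w.2.2 + v.2.2 * w.1) / 2 - v.2.1 * w.2.1 := rfl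

theorem mink_comm (v w : ℝ × ℝ × ℝ) : mink v w = mink w v := by
  simp only [mink_apply]; ring

theorem mink_hvec (z w : ℍ) : mink (hvec z) (hvec w) = Real.cosh (dist z w) := by
  have hz := z.im_pos
  have hw := w.im_pos
  rw [UpperHalfPlane.cosh_dist, Complex.dist_eq, Complex.sq_norm, Complex.normSq_apply]
  simp only [mink_apply, hvec, Complex.sub_re, Complex.sub_im, UpperHalfPlane.coe_re,
    UpperHalfPlane.coe_im]
  field_simp
  ring

theorem mink_hvec_self (z : ℍ) : mink (hvec z) (hvec z) = 1 := by
  rw [mink_hvec, dist_self, Real.cosh_zero]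

theorem hvec_fst_pos (z : ℍ) : 0 < (hvec z).1 := one_div_pos.2 z.im_pos

theorem hvec_injective : Function.Injective hvec := by
  intro z w h
  have hz := z.im_pos
  have hw := w.im_pos
  have h1 : z.im = w.im := by
    have := congrArg Prod.fst h
    simpa [hvec] using this
  have h2 : z.re = w.re := by
    have := congrArg (fun v => v.2.1) h
    simp only [hvec, h1] at this
    field_simp at this
    exact this
  exact UpperHalfPlane.ext_re_im h2 h1

/-- The form is negative definite on the orthogonal complement of a point of the hyperboloid.
Eliminating the last coordinates by the two hypotheses exhibits minus a sum of squares. -/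
theorem sq_mul_mink_self_eq {v z : ℝ × ℝ × ℝ} (hz : mink z z = 1) (h : mink v z = 0) :
    z.1 ^ 2 * mink v v = -((z.1 * v.2.1 - z.2.1 * v.1) ^ 2 + v.1 ^ 2) := by
  simp only [mink_apply] at *
  obtain ⟨a, b, c⟩ := z
  obtain ⟨p, q, r⟩ := v
  simp only at *
  linear_combination (2 * a * p) * h - p ^ 2 * hz

theorem mink_self_nonpos {v : ℝ × ℝ × ℝ} {z : ℍ} (h : mink v (hvec z) = 0) : mink v v ≤ 0 := by
  have h1 := sq_mul_mink_self_eq (mink_hvec_self z) h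
  have h2 := hvec_fst_pos z
  by_contra! h3
  have : 0 < (hvec z).1 ^ 2 * mink v v := by positivity
  nlinarith [sq_nonneg ((hvec z).1 * v.2.1 - (hvec z).2.1 * v.1), sq_nonneg v.1]

theorem eq_zero_of_mink_self_eq_zero {v : ℝ × ℝ × ℝ} {z : ℍ} (h : mink v (hvec z) = 0)
    (h0 : mink v v = 0) : v = 0 := by
  have h1 := sq_mul_mink_self_eq (mink_hvec_self z) h
  have h2 := hvec_fst_pos z
  rw [h0, mul_zero] at h1
  have hp : v.1 = 0 := by
    nlinarith [sq_nonneg ((hvec z).1 * v.2.1 - (hvec z).2.1 * v.1), sq_nonneg v.1]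
  have hq : v.2.1 = 0 := by
    rw [hp] at h1
    have : (hvec z).1 * v.2.1 = 0 := by nlinarith [sq_nonneg ((hvec z).1 * v.2.1)]
    exact (mul_eq_zero.1 this).resolve_left h2.ne'
  have hr : v.2.2 = 0 := by
    simp only [mink_apply, hp, hq] at h
    have : v.2.2 * (hvec z).1 = 0 := by linarith
    exact (mul_eq_zero.1 this).resolve_right h2.ne'
  exact Prod.ext hp (Prod.ext hq hr)

/-- The reverse Cauchy-Schwarz inequality. -/
theorem mink_self_le_sq (v : ℝ × ℝ × ℝ) (z : ℍ) : mink v v ≤ mink v (hvec z) ^ 2 := by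
  have h : mink (v - mink v (hvec z) • hvec z) (hvec z) = 0 := by
    simp [mink_hvec_self]
  have h1 := mink_self_nonpos h
  simp only [map_sub, LinearMap.sub_apply, map_smul, LinearMap.smul_apply, smul_eq_mul,
    mink_hvec_self, mink_comm (hvec z) v] at h1
  nlinarith

theorem mink_sum_sum {ι : Type*} (s : Finset ι) (α β : ι → ℝ) (a b : ι → ℍ) :
    mink (∑ i ∈ s, α i • hvec (a i)) (∑ j ∈ s, β j • hvec (b j)) =
      ∑ i ∈ s, ∑ j ∈ s, α i * β j * Real.cosh (dist (a i) (b j)) := by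
  simp only [map_sum, LinearMap.sum_apply, map_smul, LinearMap.smul_apply, smul_eq_mul, mink_hvec,
    Finset.mul_sum]
  rw [Finset.sum_comm]
  refine Finset.sum_congr rfl fun i _ => Finset.sum_congr rfl fun j _ => ?_
  ring

/-- Reverse Cauchy-Schwarz for `∑ α i • hvec (a i)` against `hvec z`. This is how the geometry of
the source enters Kirszbraun's theorem. -/
theorem sum_sum_cosh_le_sq {ι : Type*} (s : Finset ι) (α : ι → ℝ) (a : ι → ℍ) (z : ℍ) :
    ∑ i ∈ s, ∑ j ∈ s, α i * α j * Real.cosh (dist (a i) (a j)) ≤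
      (∑ i ∈ s, α i * Real.cosh (dist z (a i))) ^ 2 := by
  rw [← mink_sum_sum]
  refine (mink_self_le_sq _ z).trans_eq ?_
  simp only [map_sum, LinearMap.sum_apply, map_smul, LinearMap.smul_apply, smul_eq_mul, mink_hvec,
    dist_comm z]

theorem exists_hvec_eq {v : ℝ × ℝ × ℝ} (h : 0 < v.1) (h1 : mink v v = 1) : ∃ z, hvec z = v := by
  refine ⟨⟨⟨v.2.1 / v.1, 1 / v.1⟩, by simpa using h⟩, ?_⟩
  simp only [mink_apply] at h1
  refine Prod.ext ?_ (Prod.ext ?_ ?_)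
  · simp [hvec, UpperHalfPlane.im]
  · simp only [hvec, UpperHalfPlane.im, UpperHalfPlane.re]
    field_simp
  · simp only [hvec, UpperHalfPlane.im, UpperHalfPlane.re]
    field_simp
    linarith

/-! ### Segments -/

/-- The difference of the two sides is orthogonal to `hvec z` and has square zero, so it vanishes by
definiteness on the orthogonal complement. -/
theorem sinh_dist_smul_hvec {a b z : ℍ} (h : z ∈ hypSegment a b) :
    Real.sinh (dist a b) • hvec z =
      Real.sinh (dist z b) • hvec a + Real.sinh (dist a z) • hvec b := by
  have hab : dist a b = dist a z + dist z b := h.symm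
  have h1 : mink (hvec a) (hvec z) = Real.cosh (dist a z) := mink_hvec _ _
  have h2 : mink (hvec b) (hvec z) = Real.cosh (dist z b) := by rw [mink_hvec, dist_comm]
  have h2' : mink (hvec z) (hvec b) = Real.cosh (dist z b) := mink_hvec _ _
  have h1' : mink (hvec z) (hvec a) = Real.cosh (dist a z) := by rw [mink_hvec, dist_comm]
  have h3 : mink (hvec a) (hvec b) = Real.cosh (dist a z + dist z b) := by rw [mink_hvec, hab]
  have h3' : mink (hvec b) (hvec a) = Real.cosh (dist a z + dist z b) := by
    rw [mink_hvec, dist_comm, hab]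
  rw [hab]
  set p := dist a z
  set q := dist z b
  have e1 := Real.cosh_sq p
  have e2 := Real.cosh_sq q
  rw [← sub_eq_zero]
  refine eq_zero_of_mink_self_eq_zero (z := z) ?_ ?_
  · simp only [map_sub, map_add, LinearMap.sub_apply, LinearMap.add_apply, map_smul,
      LinearMap.smul_apply, smul_eq_mul, mink_hvec_self, h1, h2, Real.sinh_add]
    ring
  · simp only [map_sub, map_add, LinearMap.sub_apply, LinearMap.add_apply, map_smul,
      LinearMap.smul_apply, smul_eq_mul, mink_hvec_self, h1, h2, h3, h1', h2', h3',
      Real.sinh_add, Real.cosh_add]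
    linear_combination (-Real.sinh q ^ 2) * e1 - (Real.sinh p ^ 2) * e2

/-- The normalization of `z` determines the `cosh` and, up to a sign fixed by `s, t ≥ 0`, the `sinh`
of both distances. The addition formula then gives `cosh (dist a b)`. -/
theorem mem_hypSegment_of_hvec {a b z : ℍ} {s t : ℝ} (hs : 0 ≤ s) (ht : 0 ≤ t)
    (h : hvec z = s • hvec a + t • hvec b) : z ∈ hypSegment a b := by
  set C := Real.cosh (dist a b) with hC
  have hCab : mink (hvec a) (hvec b) = C := mink_hvec _ _
  have hCba : mink (hvec b) (hvec a) = C := by rw [mink_comm, hCab]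
  have hq : s ^ 2 + t ^ 2 + 2 * s * t * C = 1 := by
    have := mink_hvec_self z
    rw [h] at this
    simp only [map_add, LinearMap.add_apply, map_smul, LinearMap.smul_apply, smul_eq_mul,
      mink_hvec_self, hCab, hCba] at this
    linarith
  have h1 : Real.cosh (dist a z) = s + t * C := by
    rw [← mink_hvec, h]
    simp [mink_hvec_self, hCab]
  have h2 : Real.cosh (dist z b) = s * C + t := by
    rw [← mink_hvec, h]
    simp [mink_hvec_self, hCab]
  have hS := Real.cosh_sq (dist a b)
  rw [← hC] at hS
  have hS0 : 0 ≤ Real.sinh (dist a b) := Real.sinh_nonneg_iff.2 dist_nonneg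
  have h3 : Real.sinh (dist a z) = t * Real.sinh (dist a b) := by
    refine (sq_eq_sq₀ (Real.sinh_nonneg_iff.2 dist_nonneg) (by positivity)).1 ?_
    have := Real.cosh_sq (dist a z)
    rw [h1] at this
    linear_combination hq - this - t ^ 2 * hS + 2 * t ^ 2 * hS
  have h4 : Real.sinh (dist z b) = s * Real.sinh (dist a b) := by
    refine (sq_eq_sq₀ (Real.sinh_nonneg_iff.2 dist_nonneg) (by positivity)).1 ?_
    have := Real.cosh_sq (dist z b)
    rw [h2] at this
    linear_combination hq - this + s ^ 2 * hS
  have h5 : Real.cosh (dist a z + dist z b) = C := by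
    rw [Real.cosh_add, h1, h2, h3, h4]
    linear_combination C * hq - s * t * hS
  change dist a z + dist z b = dist a b
  have := Real.cosh_strictMonoOn.injOn (Set.mem_Ici.2 (add_nonneg dist_nonneg dist_nonneg))
    (Set.mem_Ici.2 dist_nonneg) h5
  exact this

theorem mem_hypSegment_iff {a b z : ℍ} :
    z ∈ hypSegment a b ↔ ∃ s t : ℝ, 0 ≤ s ∧ 0 ≤ t ∧ hvec z = s • hvec a + t • hvec b := by
  refine ⟨fun h => ?_, fun ⟨s, t, hs, ht, h⟩ => mem_hypSegment_of_hvec hs ht h⟩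
  rcases (dist_nonneg (x := a) (y := b)).eq_or_lt with h0 | h0
  · have h1 : dist a z + dist z b = dist a b := h
    have h2 : a = z := by
      rw [← dist_eq_zero]
      linarith [dist_nonneg (x := a) (y := z), dist_nonneg (x := z) (y := b)]
    exact ⟨1, 0, zero_le_one, le_rfl, by simp [h2]⟩
  · have hS : 0 < Real.sinh (dist a b) := Real.sinh_pos_iff.2 h0
    have h1 : 0 ≤ Real.sinh (dist z b) := Real.sinh_nonneg_iff.2 dist_nonneg
    have h2 : 0 ≤ Real.sinh (dist a z) := Real.sinh_nonneg_iff.2 dist_nonneg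
    refine ⟨Real.sinh (dist z b) / Real.sinh (dist a b),
      Real.sinh (dist a z) / Real.sinh (dist a b), by positivity, by positivity, ?_⟩
    have h3 := congrArg ((Real.sinh (dist a b))⁻¹ • ·) (sinh_dist_smul_hvec h)
    simp only [smul_add, smul_smul, inv_mul_cancel₀ hS.ne', one_smul] at h3
    rw [h3, div_eq_inv_mul, div_eq_inv_mul]

theorem hypSegment_comm (a b : ℍ) : hypSegment a b = hypSegment b a := by
  ext z
  change dist a z + dist z b = dist a b ↔ dist b z + dist z a = dist b a
  rw [dist_comm b z, dist_comm z a, dist_comm b a, add_comm]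

theorem hypSegment_self (a : ℍ) : hypSegment a a = {a} := by
  ext z
  change dist a z + dist z a = dist a a ↔ z = a
  rw [dist_self, dist_comm z a]
  constructor
  · intro h
    exact (dist_eq_zero.1 (by linarith : dist a z = 0)).symm
  · rintro rfl
    simp

theorem left_mem_hypSegment (a b : ℍ) : a ∈ hypSegment a b := by simp [hypSegment]

theorem right_mem_hypSegment (a b : ℍ) : b ∈ hypSegment a b := by simp [hypSegment]

theorem isClosed_hypSegment (a b : ℍ) : IsClosed (hypSegment a b) :=
  isClosed_eq (by fun_prop) continuous_const

theorem sinh_mul_cosh_dist {a b z : ℍ} (h : z ∈ hypSegment a b) (w : ℍ) :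
    Real.sinh (dist a b) * Real.cosh (dist z w) =
      Real.sinh (dist z b) * Real.cosh (dist a w) + Real.sinh (dist a z) * Real.cosh (dist b w) := by
  have := congrArg (fun v => mink v (hvec w)) (sinh_dist_smul_hvec h)
  simpa only [map_add, LinearMap.add_apply, map_smul, LinearMap.smul_apply, smul_eq_mul,
    mink_hvec] using this

theorem sinh_mul_cosh_sub (L p q : ℝ) :
    Real.sinh (L - p) * Real.cosh q + Real.sinh p * Real.cosh (L - q) =
      Real.sinh L * Real.cosh (p - q) := by
  simp only [Real.sinh_sub, Real.cosh_sub]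
  ring

/-- Distance from `a` is an isometric coordinate on the segment, so matching points by this
distance, as the gluing does, preserves distances along sides. -/
theorem dist_eq_abs_of_mem_hypSegment {a b z w : ℍ} (hz : z ∈ hypSegment a b)
    (hw : w ∈ hypSegment a b) : dist z w = |dist a z - dist a w| := by
  have hz' : dist a z + dist z b = dist a b := hz
  have hw' : dist a w + dist w b = dist a b := hw
  rcases (dist_nonneg (x := a) (y := b)).eq_or_lt with h0 | h0
  · have h1 : a = z := by
      rw [← dist_eq_zero]
      linarith [dist_nonneg (x := a) (y := z), dist_nonneg (x := z) (y := b)]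
    have h2 : a = w := by
      rw [← dist_eq_zero]
      linarith [dist_nonneg (x := a) (y := w), dist_nonneg (x := w) (y := b)]
    simp [← h1, ← h2]
  · have h := sinh_mul_cosh_dist hz w
    rw [dist_comm b w, show dist z b = dist a b - dist a z by linarith,
      show dist w b = dist a b - dist a w by linarith, sinh_mul_cosh_sub] at h
    have h1 := mul_left_cancel₀ (Real.sinh_pos_iff.2 h0).ne' h
    rw [← Real.cosh_abs (dist a z - dist a w)] at h1
    exact Real.cosh_strictMonoOn.injOn (Set.mem_Ici.2 dist_nonneg) (Set.mem_Ici.2 (abs_nonneg _)) h1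

theorem exists_mem_hypSegment (a b : ℍ) {s : ℝ} (hs : s ∈ Set.Icc 0 (dist a b)) :
    ∃ z ∈ hypSegment a b, dist a z = s := by
  obtain ⟨hs0, hs1⟩ := hs
  rcases (dist_nonneg (x := a) (y := b)).eq_or_lt with h0 | h0
  · exact ⟨a, left_mem_hypSegment a b, by rw [dist_self]; linarith⟩
  set L := dist a b
  have hS : 0 < Real.sinh L := Real.sinh_pos_iff.2 h0
  have hab : mink (hvec a) (hvec b) = Real.cosh L := mink_hvec _ _
  have hba : mink (hvec b) (hvec a) = Real.cosh L := by rw [mink_comm, hab]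
  have h1 : 0 ≤ Real.sinh (L - s) := Real.sinh_nonneg_iff.2 (by linarith)
  have h2 : 0 ≤ Real.sinh s := Real.sinh_nonneg_iff.2 hs0
  have e1 := Real.cosh_sq L
  have e2 := Real.cosh_sq s
  -- The coefficients are those forced by `sinh_dist_smul_hvec`.
  obtain ⟨z, hz⟩ := exists_hvec_eq
    (v := (Real.sinh (L - s) / Real.sinh L) • hvec a + (Real.sinh s / Real.sinh L) • hvec b) (by
      have ha := hvec_fst_pos a
      have hb := hvec_fst_pos b
      simp only [Prod.fst_add, Prod.smul_fst, smul_eq_mul]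
      rcases hs0.eq_or_lt with h | h
      · have : 0 < Real.sinh (L - s) := Real.sinh_pos_iff.2 (by linarith)
        positivity
      · have : 0 < Real.sinh s := Real.sinh_pos_iff.2 h
        positivity) (by
      simp only [map_add, LinearMap.add_apply, map_smul, LinearMap.smul_apply, smul_eq_mul,
        mink_hvec_self, hab, hba, Real.sinh_sub]
      field_simp
      linear_combination (Real.sinh L ^ 2) * e2 - (Real.sinh s ^ 2) * e1)
  refine ⟨z, mem_hypSegment_of_hvec (by positivity) (by positivity) hz, ?_⟩
  refine Real.cosh_strictMonoOn.injOn (Set.mem_Ici.2 dist_nonneg) (Set.mem_Ici.2 hs0) ?_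
  rw [← mink_hvec, hz]
  simp only [map_add, map_smul, smul_eq_mul, mink_hvec_self, hab, Real.sinh_sub]
  field_simp
  ring

/-! ### Existence of comparison triangles -/

/-- Two vertices are put on the imaginary axis at heights `1` and `exp L`. The distances to them
give two linear equations for the outer coordinates `x, w` of the third vertex. The middle one must
be a square root of `x * w - 1`, and the triangle inequalities say that this is nonnegative. -/
theorem exists_hyp_triangle {L p q : ℝ} (hL : 0 ≤ L) (hp : 0 ≤ p) (hq : 0 ≤ q)
    (h1 : L ≤ p + q) (h2 : p ≤ L + q) (h3 : q ≤ L + p) :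
    ∃ a b c : ℍ, dist a b = L ∧ dist a c = p ∧ dist b c = q := by
  have key : ∀ t : ℝ, 0 ≤ t → dist (UpperHalfPlane.I) ⟨⟨0, Real.exp t⟩, Real.exp_pos t⟩ = t := by
    intro t ht
    rw [UpperHalfPlane.dist_of_re_eq (by simp [UpperHalfPlane.re, UpperHalfPlane.I])]
    simp [UpperHalfPlane.im, UpperHalfPlane.I, Real.dist_eq, abs_of_nonneg ht]
  rcases hL.eq_or_lt with h0 | h0
  · have : p = q := by linarith
    subst this
    exact ⟨UpperHalfPlane.I, UpperHalfPlane.I, _, by rw [dist_self, h0], key p hp, key p hp⟩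
  have hS : 0 < Real.sinh L := Real.sinh_pos_iff.2 h0
  have hpq : 1 ≤ (Real.cosh q - Real.cosh p * Real.exp (-L)) / Real.sinh L *
      ((Real.cosh p * Real.exp L - Real.cosh q) / Real.sinh L) := by
    rw [div_mul_div_comm, le_div_iff₀ (by positivity), one_mul]
    have e1 : Real.exp L * Real.exp (-L) = 1 := by rw [← Real.exp_add]; simp
    have e2 : Real.exp L + Real.exp (-L) = 2 * Real.cosh L := by rw [Real.cosh_eq]; ring
    have hc1 : Real.cosh q ≤ Real.cosh (L + p) :=
      Real.cosh_le_cosh.2 (by rwa [abs_of_nonneg hq, abs_of_nonneg (by positivity)])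
    have hc2 : Real.cosh (L - p) ≤ Real.cosh q :=
      Real.cosh_le_cosh.2 (by rw [abs_of_nonneg hq, abs_le]; constructor <;> linarith)
    -- This product equals `(x * w - 1) * sinh L ^ 2`, with `x` and `w` the two quotients in `hpq`.
    have h4 : 0 ≤ (Real.cosh (L + p) - Real.cosh q) * (Real.cosh q - Real.cosh (L - p)) :=
      mul_nonneg (by linarith) (by linarith)
    rw [Real.cosh_add, Real.cosh_sub] at h4
    have e3 := Real.cosh_sq L
    have e4 := Real.cosh_sq p
    have : (Real.cosh q - Real.cosh p * Real.exp (-L)) * (Real.cosh p * Real.exp L - Real.cosh q) =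
        Real.cosh p * Real.cosh q * (2 * Real.cosh L) - Real.cosh q ^ 2 - Real.cosh p ^ 2 := by
      linear_combination (Real.cosh p * Real.cosh q) * e2 - Real.cosh p ^ 2 * e1
    rw [this]
    have e5 : (Real.cosh L * Real.cosh p + Real.sinh L * Real.sinh p - Real.cosh q) *
        (Real.cosh q - (Real.cosh L * Real.cosh p - Real.sinh L * Real.sinh p)) =
        Real.cosh p * Real.cosh q * (2 * Real.cosh L) - Real.cosh q ^ 2 - Real.cosh p ^ 2
          - Real.sinh L * Real.sinh L := by
      linear_combination (-Real.cosh p ^ 2) * e3 - (Real.sinh L ^ 2) * e4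
    linarith
  set x := (Real.cosh q - Real.cosh p * Real.exp (-L)) / Real.sinh L with hx
  set w := (Real.cosh p * Real.exp L - Real.cosh q) / Real.sinh L with hw
  have hxw : x + w = 2 * Real.cosh p := by
    rw [hx, hw, ← add_div, div_eq_iff hS.ne', Real.sinh_eq]
    ring
  have hxw2 : x * Real.exp L + w * Real.exp (-L) = 2 * Real.cosh q := by
    have e1 : Real.exp L * Real.exp (-L) = 1 := by rw [← Real.exp_add]; simp
    rw [hx, hw, div_mul_eq_mul_div, div_mul_eq_mul_div, ← add_div, div_eq_iff hS.ne',
      Real.sinh_eq]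
    ring
  have hx0 : 0 < x := by
    have := Real.cosh_pos p
    by_contra! hneg
    nlinarith
  obtain ⟨c, hc⟩ := exists_hvec_eq (v := (x, Real.sqrt (x * w - 1), w)) hx0 (by
    simp only [mink_apply]
    have := Real.mul_self_sqrt (show 0 ≤ x * w - 1 by linarith)
    linarith)
  refine ⟨UpperHalfPlane.I, _, c, key L hL, ?_, ?_⟩
  · refine Real.cosh_strictMonoOn.injOn (Set.mem_Ici.2 dist_nonneg) (Set.mem_Ici.2 hp) ?_
    rw [← mink_hvec, hc]
    simp only [mink_apply, hvec, UpperHalfPlane.im, UpperHalfPlane.re, UpperHalfPlane.I,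
      Complex.I_re, Complex.I_im]
    linarith
  · refine Real.cosh_strictMonoOn.injOn (Set.mem_Ici.2 dist_nonneg) (Set.mem_Ici.2 hq) ?_
    rw [← mink_hvec, hc]
    simp only [mink_apply, hvec, UpperHalfPlane.im, UpperHalfPlane.re]
    rw [Real.exp_neg] at hxw2
    have := Real.exp_pos L
    field_simp at hxw2 ⊢
    linarith

/-- The spec of `triangleOfLengths` when the lengths are realized by three points of a metric
space. -/
theorem dist_triangleOfLengths {X : Type*} [MetricSpace X] (x : Fin 3 → X) (i j : Fin 3) :
    dist (triangleOfLengths (fun i j => dist (x i) (x j)) i)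
      (triangleOfLengths (fun i j => dist (x i) (x j)) j) = dist (x i) (x j) := by
  obtain ⟨a, b, c, h1, h2, h3⟩ := exists_hyp_triangle (L := dist (x 0) (x 1))
    (p := dist (x 0) (x 2)) (q := dist (x 1) (x 2)) dist_nonneg dist_nonneg dist_nonneg
    (dist_triangle_right _ _ _) (dist_triangle _ _ _) (dist_triangle_left _ _ _)
  have key : ∃ a : Fin 3 → ℍ, ∀ i j, dist (a i) (a j) = dist (x i) (x j) := by
    refine ⟨![a, b, c], fun i j => ?_⟩
    fin_cases i <;> fin_cases j <;>
      simp [h1, h2, h3, dist_comm b a, dist_comm c a, dist_comm c b, dist_comm (x 1) (x 0),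
        dist_comm (x 2) (x 0), dist_comm (x 2) (x 1)]
  exact Classical.epsilon_spec key i j

/-! ### Barycentric coordinates -/

section Bary

variable {ι κ : Type*} [Fintype ι] [Fintype κ]

/-- The linear combination of points of the hyperboloid with given barycentric coordinates. -/
def baryVec (a : ι → ℍ) (t : stdSimplex ℝ ι) : ℝ × ℝ × ℝ := ∑ i, t i • hvec (a i)

theorem stdSimplex_exists_pos (t : stdSimplex ℝ ι) : ∃ i, 0 < t i := by
  by_contra! h
  have h1 := stdSimplex.sum_eq_one t
  have h2 : ∑ i, t i ≤ 0 := Finset.sum_nonpos fun i _ => h i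
  linarith

theorem baryVec_fst_pos (a : ι → ℍ) (t : stdSimplex ℝ ι) : 0 < (baryVec a t).1 := by
  rw [baryVec, Prod.fst_sum]
  obtain ⟨i, hi⟩ := stdSimplex_exists_pos t
  exact Finset.sum_pos' (fun j _ => mul_nonneg (stdSimplex.zero_le t j) (hvec_fst_pos _).le)
    ⟨i, Finset.mem_univ i, mul_pos hi (hvec_fst_pos _)⟩

theorem mink_baryVec (a b : ι → ℍ) (s t : stdSimplex ℝ ι) :
    mink (baryVec a s) (baryVec b t) = ∑ i, ∑ j, s i * t j * Real.cosh (dist (a i) (b j)) :=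
  mink_sum_sum _ _ _ _ _

theorem mink_baryVec_pos (a : ι → ℍ) (t : stdSimplex ℝ ι) :
    0 < mink (baryVec a t) (baryVec a t) := by
  rw [mink_baryVec]
  obtain ⟨i, hi⟩ := stdSimplex_exists_pos t
  have h : ∀ i j, 0 ≤ t i * t j * Real.cosh (dist (a i) (a j)) := fun i j =>
    mul_nonneg (mul_nonneg (stdSimplex.zero_le t i) (stdSimplex.zero_le t j)) (Real.cosh_pos _).le
  refine Finset.sum_pos' (fun i _ => Finset.sum_nonneg fun j _ => h i j) ⟨i, Finset.mem_univ i, ?_⟩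
  exact Finset.sum_pos' (fun j _ => h i j)
    ⟨i, Finset.mem_univ i, mul_pos (mul_pos hi hi) (Real.cosh_pos _)⟩

/-- The point of `ℍ` with given (projective) barycentric coordinates. -/
def bary (a : ι → ℍ) (t : stdSimplex ℝ ι) : ℍ :=
  ⟨⟨(baryVec a t).2.1 / (baryVec a t).1,
    Real.sqrt (mink (baryVec a t) (baryVec a t)) / (baryVec a t).1⟩,
    div_pos (Real.sqrt_pos.2 (mink_baryVec_pos a t)) (baryVec_fst_pos a t)⟩

theorem hvec_bary (a : ι → ℍ) (t : stdSimplex ℝ ι) :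
    hvec (bary a t) = (Real.sqrt (mink (baryVec a t) (baryVec a t)))⁻¹ • baryVec a t := by
  have h1 := baryVec_fst_pos a t
  have h2 := Real.sqrt_pos.2 (mink_baryVec_pos a t)
  have h3 := Real.sq_sqrt (mink_baryVec_pos a t).le
  have h4 := mink_apply (baryVec a t) (baryVec a t)
  simp only [hvec, bary, UpperHalfPlane.im, UpperHalfPlane.re]
  set q := Real.sqrt (mink (baryVec a t) (baryVec a t))
  refine Prod.ext ?_ (Prod.ext ?_ ?_)
  · simp only [Prod.smul_fst, smul_eq_mul]
    field_simp
  · simp only [Prod.smul_fst, Prod.smul_snd, smul_eq_mul]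
    field_simp
  · simp only [Prod.smul_snd, smul_eq_mul]
    field_simp
    linarith

theorem eq_bary_of_hvec {a : ι → ℍ} {t : stdSimplex ℝ ι} {z : ℍ} {c : ℝ} (hc : 0 ≤ c)
    (h : hvec z = c • baryVec a t) : z = bary a t := by
  apply hvec_injective
  have h0 := mink_baryVec_pos a t
  have h1 := mink_hvec_self z
  rw [h] at h1
  simp only [map_smul, LinearMap.smul_apply, smul_eq_mul] at h1
  have h2 := Real.sqrt_pos.2 h0
  have h3 := Real.sq_sqrt h0.le
  rw [hvec_bary, h]
  congr 1
  rw [← h3] at h1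
  set q := Real.sqrt (mink (baryVec a t) (baryVec a t))
  have h4 : c * q = 1 := by
    have : (c * q) ^ 2 = 1 ^ 2 := by linarith
    exact (sq_eq_sq₀ (by positivity) zero_le_one).1 this
  exact eq_inv_of_mul_eq_one_left h4

theorem exists_eq_bary_of_hvec {a : ι → ℍ} {α : ι → ℝ} {z : ℍ} (hα : ∀ i, 0 ≤ α i)
    (h : hvec z = ∑ i, α i • hvec (a i)) : ∃ t, bary a t = z := by
  have hs : 0 < ∑ i, α i := by
    refine (Finset.sum_nonneg fun i _ => hα i).lt_of_ne fun h0 => ?_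
    have h1 := (Finset.sum_eq_zero_iff_of_nonneg fun i _ => hα i).1 h0.symm
    have h2 := hvec_fst_pos z
    rw [h, Finset.sum_eq_zero fun i hi => by rw [h1 i hi, zero_smul]] at h2
    exact lt_irrefl _ h2
  refine ⟨⟨fun i => α i / ∑ i, α i, fun i => div_nonneg (hα i) hs.le, ?_⟩, ?_⟩
  · rw [← Finset.sum_div, div_self hs.ne']
  · refine (eq_bary_of_hvec hs.le ?_).symm
    rw [h, baryVec, Finset.smul_sum]
    refine Finset.sum_congr rfl fun i _ => ?_
    rw [smul_smul]
    congr 1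
    change α i = _ * (α i / _)
    field_simp

theorem continuous_stdSimplex_apply (i : ι) : Continuous fun t : stdSimplex ℝ ι => t i :=
  (continuous_apply i).comp continuous_subtype_val

theorem continuous_bary (a : ι → ℍ) : Continuous (bary a) := by
  have h1 : Continuous (baryVec a) := by
    unfold baryVec
    exact continuous_finsetSum _ fun i _ => (continuous_stdSimplex_apply i).smul continuous_const
  have h2 : Continuous fun t => mink (baryVec a t) (baryVec a t) := by
    simp only [mink_apply]
    fun_prop
  refine UpperHalfPlane.isEmbedding_coe.continuous_iff.2 ?_
  have h3 : Continuous fun t => (((baryVec a t).2.1 / (baryVec a t).1,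
      Real.sqrt (mink (baryVec a t) (baryVec a t)) / (baryVec a t).1) : ℝ × ℝ) :=
    (h1.snd.fst.div h1.fst fun t => (baryVec_fst_pos a t).ne').prodMk
      (h2.sqrt.div h1.fst fun t => (baryVec_fst_pos a t).ne')
  exact Complex.equivRealProdCLM.symm.continuous.comp h3

theorem baryVec_map (a : κ → ℍ) (f : ι → κ) (t : stdSimplex ℝ ι) :
    baryVec a (stdSimplex.map f t) = baryVec (a ∘ f) t := by
  classical
  simp only [baryVec, stdSimplex.map_coe, FunOnFinite.linearMap_apply_apply, Finset.sum_smul,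
    Function.comp_apply]
  rw [← Finset.sum_fiberwise Finset.univ f]
  refine Finset.sum_congr rfl fun j _ => Finset.sum_congr rfl fun i hi => ?_
  rw [(Finset.mem_filter.1 hi).2]

theorem bary_map (a : κ → ℍ) (f : ι → κ) (t : stdSimplex ℝ ι) :
    bary a (stdSimplex.map f t) = bary (a ∘ f) t := by
  apply hvec_injective
  rw [hvec_bary, hvec_bary, baryVec_map]

theorem bary_vertex [DecidableEq ι] (a : ι → ℍ) (i : ι) : bary a (stdSimplex.vertex i) = a i := by
  refine (eq_bary_of_hvec zero_le_one ?_).symm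
  simp only [baryVec, stdSimplex.vertex_coe, one_smul]
  rw [Finset.sum_eq_single i (fun j _ hj => by rw [Pi.single_eq_of_ne hj, zero_smul])
    (fun h => absurd (Finset.mem_univ i) h), Pi.single_eq_same, one_smul]

/-- The Gram matrix of the vertices consists of the `cosh` of their distances, and it determines the
distances between barycentric points. Sides of equal length thus carry the same parametrization,
which makes barycentric coordinates compatible with gluing. -/
theorem dist_bary_congr {a b : ι → ℍ} (h : ∀ i j, dist (a i) (a j) = dist (b i) (b j))
    (s t : stdSimplex ℝ ι) : dist (bary a s) (bary a t) = dist (bary b s) (bary b t) := by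
  refine Real.cosh_strictMonoOn.injOn (Set.mem_Ici.2 dist_nonneg) (Set.mem_Ici.2 dist_nonneg) ?_
  simp only [← mink_hvec, hvec_bary, map_smul, LinearMap.smul_apply, mink_baryVec, h]

/-- Equal points have proportional coordinates by independence, and the coordinates sum to one. -/
theorem injective_bary {a : ι → ℍ} (h : LinearIndependent ℝ (hvec ∘ a)) :
    Function.Injective (bary a) := by
  intro s t hst
  have h1 := congrArg hvec hst
  rw [hvec_bary, hvec_bary, baryVec, baryVec] at h1
  set p := (Real.sqrt (mink (∑ i, s i • hvec (a i)) (∑ i, s i • hvec (a i))))⁻¹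
  set q := (Real.sqrt (mink (∑ i, t i • hvec (a i)) (∑ i, t i • hvec (a i))))⁻¹
  have hp : 0 < p := inv_pos.2 (Real.sqrt_pos.2 (mink_baryVec_pos a s))
  have h2 : ∑ i, (p * s i - q * t i) • (hvec ∘ a) i = 0 := by
    simp only [sub_smul, Finset.sum_sub_distrib, mul_smul, ← Finset.smul_sum, Function.comp_apply]
    rw [h1, sub_self]
  have h3 : ∀ i, p * s i = q * t i := fun i =>
    sub_eq_zero.1 (Fintype.linearIndependent_iff.1 h _ h2 i)
  have h4 : p = q := by
    have := Finset.sum_congr (rfl : (Finset.univ : Finset ι) = Finset.univ) fun i _ => h3 i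
    simpa [← Finset.mul_sum] using this
  refine stdSimplex.ext (funext fun i => ?_)
  have := h3 i
  rw [← h4] at this
  exact mul_left_cancel₀ hp.ne' this

end Bary

/-- Sort a linear relation by the signs of its coefficients. If all have the same sign they vanish,
as first coordinates are positive. Otherwise, unless all vanish, one vertex is a nonnegative
combination of the other two and so lies on the opposite side, against the strict triangle
inequality. -/
theorem linearIndependent_hvec {a : Fin 3 → ℍ}
    (h : ∀ i j k, i ≠ j → j ≠ k → i ≠ k → dist (a i) (a j) < dist (a i) (a k) + dist (a k) (a j)) :
    LinearIndependent ℝ (hvec ∘ a) := by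
  have rel : ∀ i j k : Fin 3, i ≠ j → j ≠ k → i ≠ k → ∀ α β γ : ℝ, 0 ≤ α → 0 ≤ β → 0 ≤ γ →
      γ • hvec (a k) = α • hvec (a i) + β • hvec (a j) → α = 0 ∧ β = 0 ∧ γ = 0 := by
    intro i j k hij hjk hik α β γ hα hβ hγ he
    have hi := hvec_fst_pos (a i)
    have hj := hvec_fst_pos (a j)
    rcases hγ.eq_or_lt with h0 | h0
    · have := congrArg Prod.fst he
      rw [← h0, zero_smul] at this
      simp only [Prod.fst_add, Prod.smul_fst, smul_eq_mul, Prod.fst_zero] at this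
      have h1 : 0 ≤ α * (hvec (a i)).1 := by positivity
      have h2 : 0 ≤ β * (hvec (a j)).1 := by positivity
      exact ⟨(mul_eq_zero.1 (by linarith : α * (hvec (a i)).1 = 0)).resolve_right hi.ne',
        (mul_eq_zero.1 (by linarith : β * (hvec (a j)).1 = 0)).resolve_right hj.ne', h0.symm⟩
    · exfalso
      have h1 : a k ∈ hypSegment (a i) (a j) := by
        refine mem_hypSegment_of_hvec (s := γ⁻¹ * α) (t := γ⁻¹ * β) (by positivity) (by positivity) ?_
        rw [mul_smul, mul_smul, ← smul_add, ← he, smul_smul, inv_mul_cancel₀ h0.ne', one_smul]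
      exact (h i j k hij hjk hik).ne' h1
  rw [Fintype.linearIndependent_iff]
  intro g hg
  rw [Fin.sum_univ_three] at hg
  simp only [Function.comp_apply] at hg
  have key : g 0 = 0 ∧ g 1 = 0 ∧ g 2 = 0 := by
    have p0 := hvec_fst_pos (a 0)
    have p1 := hvec_fst_pos (a 1)
    have p2 := hvec_fst_pos (a 2)
    have hsum := congrArg Prod.fst hg
    simp only [Prod.fst_add, Prod.smul_fst, smul_eq_mul, Prod.fst_zero] at hsum
    rcases le_total 0 (g 0) with h0 | h0 <;> rcases le_total 0 (g 1) with h1 | h1 <;>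
      rcases le_total 0 (g 2) with h2 | h2
    · have q0 := mul_nonneg h0 p0.le
      have q1 := mul_nonneg h1 p1.le
      have q2 := mul_nonneg h2 p2.le
      exact ⟨(mul_eq_zero.1 (by linarith)).resolve_right p0.ne',
        (mul_eq_zero.1 (by linarith)).resolve_right p1.ne',
        (mul_eq_zero.1 (by linarith)).resolve_right p2.ne'⟩
    · have := rel 0 1 2 (by decide) (by decide) (by decide) (g 0) (g 1) (-g 2) h0 h1 (by linarith)
        (by rw [neg_smul, eq_comm, ← sub_eq_zero, sub_neg_eq_add, hg])
      exact ⟨this.1, this.2.1, by linarith [this.2.2]⟩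
    · have := rel 0 2 1 (by decide) (by decide) (by decide) (g 0) (g 2) (-g 1) h0 h2 (by linarith)
        (by rw [neg_smul, eq_comm, ← sub_eq_zero, sub_neg_eq_add, ← hg]; abel)
      exact ⟨this.1, by linarith [this.2.2], this.2.1⟩
    · have := rel 1 2 0 (by decide) (by decide) (by decide) (-g 1) (-g 2) (g 0) (by linarith)
        (by linarith) h0 (by rw [neg_smul, neg_smul, ← sub_eq_zero, ← hg]; abel)
      exact ⟨this.2.2, by linarith [this.1], by linarith [this.2.1]⟩
    · have := rel 1 2 0 (by decide) (by decide) (by decide) (g 1) (g 2) (-g 0) h1 h2 (by linarith)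
        (by rw [neg_smul, eq_comm, ← sub_eq_zero, sub_neg_eq_add, ← hg]; abel)
      exact ⟨by linarith [this.2.2], this.1, this.2.1⟩
    · have := rel 0 2 1 (by decide) (by decide) (by decide) (-g 0) (-g 2) (g 1) (by linarith)
        (by linarith) h1 (by rw [neg_smul, neg_smul, ← sub_eq_zero, ← hg]; abel)
      exact ⟨by linarith [this.1], this.2.2, by linarith [this.2.1]⟩
    · have := rel 0 1 2 (by decide) (by decide) (by decide) (-g 0) (-g 1) (g 2) (by linarith)
        (by linarith) h2 (by rw [neg_smul, neg_smul, ← sub_eq_zero, ← hg]; abel)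
      exact ⟨by linarith [this.1], by linarith [this.2.1], this.2.2⟩
    · have q0 := mul_nonneg (neg_nonneg.2 h0) p0.le
      have q1 := mul_nonneg (neg_nonneg.2 h1) p1.le
      have q2 := mul_nonneg (neg_nonneg.2 h2) p2.le
      exact ⟨(mul_eq_zero.1 (by linarith)).resolve_right p0.ne',
        (mul_eq_zero.1 (by linarith)).resolve_right p1.ne',
        (mul_eq_zero.1 (by linarith)).resolve_right p2.ne'⟩
  intro i
  fin_cases i
  exacts [key.1, key.2.1, key.2.2]

/-- Segments are the images of the sides of the simplex. -/
theorem mem_hypSegment_iff_bary {a : Fin 3 → ℍ} {i j : Fin 3} {z : ℍ} :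
    z ∈ hypSegment (a i) (a j) ↔
      ∃ s : stdSimplex ℝ (Fin 2), bary a (stdSimplex.map ![i, j] s) = z := by
  simp only [bary_map]
  constructor
  · intro h
    obtain ⟨s, t, hs, ht, h⟩ := mem_hypSegment_iff.1 h
    refine exists_eq_bary_of_hvec (α := ![s, t]) (fun k => by fin_cases k <;> simp [hs, ht]) ?_
    simp [Fin.sum_univ_two, h]
  · rintro ⟨s, rfl⟩
    have h0 : 0 ≤ (Real.sqrt (mink (baryVec (a ∘ ![i, j]) s) (baryVec (a ∘ ![i, j]) s)))⁻¹ :=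
      inv_nonneg.2 (Real.sqrt_nonneg _)
    have h1 := hvec_bary (a ∘ ![i, j]) s
    set c := (Real.sqrt (mink (baryVec (a ∘ ![i, j]) s) (baryVec (a ∘ ![i, j]) s)))⁻¹
    refine mem_hypSegment_of_hvec (mul_nonneg h0 (stdSimplex.zero_le s 0))
      (mul_nonneg h0 (stdSimplex.zero_le s 1)) ?_
    rw [h1, baryVec, Fin.sum_univ_two, smul_add, smul_smul, smul_smul]
    rfl

theorem mem_hypTriangle_iff_bary {a : Fin 3 → ℍ} {z : ℍ} :
    z ∈ hypTriangle a ↔ ∃ t, bary a t = z := by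
  constructor
  · rintro ⟨q, hq, hz⟩
    obtain ⟨s, t, hs, ht, h⟩ := mem_hypSegment_iff.1 hq
    obtain ⟨s', t', hs', ht', h'⟩ := mem_hypSegment_iff.1 hz
    refine exists_eq_bary_of_hvec (α := ![s', t' * s, t' * t])
      (fun k => by fin_cases k <;> simp <;> positivity) ?_
    simp [Fin.sum_univ_three, h, h', mul_smul, add_assoc]
  · rintro ⟨t, rfl⟩
    have t0 := stdSimplex.zero_le t 0
    have t1 := stdSimplex.zero_le t 1
    have t2 := stdSimplex.zero_le t 2
    have hc0 : 0 ≤ (Real.sqrt (mink (baryVec a t) (baryVec a t)))⁻¹ :=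
      inv_nonneg.2 (Real.sqrt_nonneg _)
    have h1 := hvec_bary a t
    set c := (Real.sqrt (mink (baryVec a t) (baryVec a t)))⁻¹
    rw [baryVec, Fin.sum_univ_three] at h1
    -- If `t 1 + t 2 = 0` the point is the vertex `a 0` and any point of the opposite side will do.
    -- Otherwise project from `a 0` to the opposite side by renormalizing the last two coordinates.
    rcases (add_nonneg t1 t2).eq_or_lt with h0 | h0
    · have e1 : t 1 = 0 := by linarith
      have e2 : t 2 = 0 := by linarith
      refine ⟨a 1, left_mem_hypSegment _ _, ?_⟩
      refine mem_hypSegment_of_hvec (s := c * t 0) (t := 0) (mul_nonneg hc0 t0) le_rfl ?_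
      rw [h1, e1, e2]
      simp [mul_smul]
    · set r : stdSimplex ℝ (Fin 2) := ⟨![t 1 / (t 1 + t 2), t 2 / (t 1 + t 2)], by
        refine ⟨fun k => by fin_cases k <;> simp <;> positivity, ?_⟩
        rw [Fin.sum_univ_two]
        simp only [Matrix.cons_val_zero, Matrix.cons_val_one]
        field_simp⟩ with hr
      refine ⟨bary a (stdSimplex.map ![1, 2] r), mem_hypSegment_iff_bary.2 ⟨r, rfl⟩, ?_⟩
      have h2 := hvec_bary (a ∘ ![1, 2]) r
      have hd := Real.sqrt_pos.2 (mink_baryVec_pos (a ∘ ![1, 2]) r)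
      rw [← bary_map] at h2
      set d := Real.sqrt (mink (baryVec (a ∘ ![1, 2]) r) (baryVec (a ∘ ![1, 2]) r))
      refine mem_hypSegment_of_hvec (s := c * t 0) (t := c * (t 1 + t 2) * d) (mul_nonneg hc0 t0)
        (by positivity) ?_
      rw [h1, h2, smul_smul, mul_assoc, mul_inv_cancel₀ hd.ne', mul_one, baryVec, Fin.sum_univ_two]
      have r0 : r 0 = t 1 / (t 1 + t 2) := rfl
      have r1 : r 1 = t 2 / (t 1 + t 2) := rfl
      rw [r0, r1]
      simp only [Function.comp_apply, Matrix.cons_val_zero, Matrix.cons_val_one, smul_add,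
        smul_smul]
      rw [add_assoc]
      congr 3 <;> field_simp

/-! ### Convexity of the metric of a `CAT(-1)` space -/

section Kirszbraun

variable {X : Type v} [MetricSpace X]

theorem IsGeodesicFromTo.symm {c : ℝ → X} {x y : X} (h : IsGeodesicFromTo c x y) :
    IsGeodesicFromTo (fun t => c (dist x y - t)) y x where
  source := by simpa using h.target
  target := by simpa [dist_comm y x] using h.source
  isometric s hs t ht := by
    rw [dist_comm y x] at hs ht
    rw [h.isometric _ ⟨by linarith [hs.2], by linarith [hs.1]⟩ _
      ⟨by linarith [ht.2], by linarith [ht.1]⟩, abs_sub_comm]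
    congr 1
    ring

theorem IsGeodesicFromTo.dist_left {c : ℝ → X} {x y : X} (h : IsGeodesicFromTo c x y) {s : ℝ}
    (hs : s ∈ Set.Icc 0 (dist x y)) : dist x (c s) = s := by
  have := h.isometric 0 ⟨le_rfl, dist_nonneg⟩ s hs
  rwa [h.source, zero_sub, abs_neg, abs_of_nonneg hs.1] at this

theorem IsGeodesicFromTo.dist_right {c : ℝ → X} {x y : X} (h : IsGeodesicFromTo c x y) {s : ℝ}
    (hs : s ∈ Set.Icc 0 (dist x y)) : dist (c s) y = dist x y - s := by
  have := h.isometric s hs (dist x y) ⟨dist_nonneg, le_rfl⟩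
  rwa [h.target, abs_sub_comm, abs_of_nonneg (by linarith [hs.2])] at this

theorem cosh_dist_le_cosh_dist {Y Z : Type*} [PseudoMetricSpace Y] [PseudoMetricSpace Z]
    {y y' : Y} {z z' : Z} :
    Real.cosh (dist y y') ≤ Real.cosh (dist z z') ↔ dist y y' ≤ dist z z' := by
  rw [Real.cosh_le_cosh, abs_of_nonneg dist_nonneg, abs_of_nonneg dist_nonneg]

/-- In `ℍ` this is the equality `sinh_mul_cosh_dist`; comparison makes it an inequality. It is the
integrated form of `f'' ≥ f` for `f = cosh d(·, z)` along a geodesic. -/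
theorem IsCATNegOne.sinh_mul_cosh_le (hX : IsCATNegOne X) {c : ℝ → X} {x y : X}
    (hc : IsGeodesicFromTo c x y) (z : X) {s : ℝ} (hs : s ∈ Set.Icc 0 (dist x y)) :
    Real.sinh (dist x y) * Real.cosh (dist (c s) z) ≤
      Real.sinh (dist x y - s) * Real.cosh (dist x z) + Real.sinh s * Real.cosh (dist y z) := by
  obtain ⟨c', hc'⟩ := hX.geodesic x z
  obtain ⟨a, b, d, h1, h2, h3⟩ := exists_hyp_triangle (L := dist x y) (p := dist x z)
    (q := dist y z) dist_nonneg dist_nonneg dist_nonneg (dist_triangle_right _ _ _)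
    (dist_triangle _ _ _) (dist_triangle_left _ _ _)
  obtain ⟨p, hp, hps⟩ := exists_mem_hypSegment a b (s := s) (by rwa [h1])
  have h4 := hX.comparison x y z c c' hc hc' a b d h1 h2 h3 s hs (dist x z) ⟨dist_nonneg, le_rfl⟩
    p hp d (right_mem_hypSegment a d) hps h2
  rw [hc'.target] at h4
  have h5 := sinh_mul_cosh_dist hp d
  have h6 : dist p b = dist x y - s := by
    have : dist a p + dist p b = dist a b := hp
    linarith
  rw [h6, hps, h1, h2, h3] at h5
  rw [← h5]
  exact mul_le_mul_of_nonneg_left (cosh_dist_le_cosh_dist.2 h4)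
    (Real.sinh_nonneg_iff.2 dist_nonneg)

/-- The midpoint does not depend on `z`, so the inequality may be summed over several centres. The
factor `cosh (dist x y / 2)` carries the strong convexity. -/
theorem IsCATNegOne.exists_midpoint (hX : IsCATNegOne X) (x y : X) :
    ∃ m, ∀ z, 2 * Real.cosh (dist x y / 2) * Real.cosh (dist m z) ≤
      Real.cosh (dist x z) + Real.cosh (dist y z) := by
  obtain ⟨c, hc⟩ := hX.geodesic x y
  refine ⟨c (dist x y / 2), fun z => ?_⟩
  have h := hX.sinh_mul_cosh_le hc z (s := dist x y / 2)
    ⟨by positivity, by linarith [dist_nonneg (x := x) (y := y)]⟩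
  rcases (dist_nonneg (x := x) (y := y)).eq_or_lt with h0 | h0
  · have hxy : x = y := dist_eq_zero.1 h0.symm
    subst hxy
    have := hc.source
    rw [dist_self] at *
    simp only [zero_div, Real.cosh_zero]
    rw [this]
    linarith
  · rw [sub_half] at h
    have hS : 0 < Real.sinh (dist x y / 2) := Real.sinh_pos_iff.2 (by positivity)
    have h2 : Real.sinh (dist x y) = 2 * Real.sinh (dist x y / 2) * Real.cosh (dist x y / 2) := by
      rw [← Real.sinh_two_mul]
      congr 1
      ring
    rw [h2] at h
    refine le_of_mul_le_mul_left ?_ hS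
    linarith

theorem one_add_sq_div_two_le_cosh {x : ℝ} (hx : 0 ≤ x) : 1 + x ^ 2 / 2 ≤ Real.cosh x := by
  have h1 : x / 2 ≤ Real.sinh (x / 2) := Real.self_le_sinh_iff.2 (by positivity)
  have h2 : Real.cosh x = 2 * Real.sinh (x / 2) ^ 2 + 1 := by
    have h3 := Real.cosh_two_mul (x / 2)
    rw [mul_div_cancel₀ x two_ne_zero, Real.cosh_sq] at h3
    linarith
  have h4 : (x / 2) ^ 2 ≤ Real.sinh (x / 2) ^ 2 := by gcongr
  linarith

/-- A directed family of closed sets which are convex in a weak sense has a common point, if there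
is a strongly convex function which is bounded on one of them. -/
theorem exists_forall_mem_of_midpoint [CompleteSpace X] {ι : Type*} {C : ι → Set X}
    (hdir : Directed (· ⊇ ·) C) (hclosed : ∀ i, IsClosed (C i)) (hne : ∀ i, (C i).Nonempty)
    {mid : X → X → X} (hmid : ∀ i, ∀ y ∈ C i, ∀ y' ∈ C i, mid y y' ∈ C i) {D : X → ℝ}
    (hD : ∀ y y', 2 * Real.cosh (dist y y' / 2) * D (mid y y') ≤ D y + D y')
    {δ : ℝ} (hδ : 0 < δ) (hδD : ∀ y, δ ≤ D y) (i₀ : ι) {B : ℝ} (hB : ∀ y ∈ C i₀, D y ≤ B) :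
    ∃ y, ∀ i, y ∈ C i := by
  set r : ι → ℝ := fun i => sInf (D '' C i) with hr
  have hbdd : ∀ i, BddBelow (D '' C i) := fun i => ⟨δ, by rintro _ ⟨y, _, rfl⟩; exact hδD y⟩
  have hr_le : ∀ i, ∀ y ∈ C i, r i ≤ D y := fun i y hy => csInf_le (hbdd i) ⟨y, hy, rfl⟩
  have hrδ : ∀ i, δ ≤ r i := fun i =>
    le_csInf ((hne i).image D) (by rintro _ ⟨y, _, rfl⟩; exact hδD y)
  have hrB : ∀ i, r i ≤ B := by
    intro i
    obtain ⟨k, hki, hk0⟩ := hdir i i₀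
    obtain ⟨y, hy⟩ := hne k
    exact (hr_le i y (hki hy)).trans (hB y (hk0 hy))
  have hbddr : BddAbove (Set.range r) := ⟨B, by rintro _ ⟨i, rfl⟩; exact hrB i⟩
  -- The infima of `D` increase along the family. Near-minimizers of `D` on a set whose infimum is
  -- close to `R` cannot be far apart, as their midpoint would fall below this infimum.
  set R := ⨆ i, r i with hR
  have hrR : ∀ i, r i ≤ R := fun i => le_ciSup hbddr i
  have hRδ : δ ≤ R := (hrδ i₀).trans (hrR i₀)
  have : Nonempty ι := ⟨i₀⟩
  let A : ι × {η : ℝ // 0 < η} → Set X := fun p => {y | y ∈ C p.1 ∧ D y < R + p.2.1}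
  have hAne : ∀ p, (A p).Nonempty := by
    rintro ⟨i, η, hη⟩
    obtain ⟨_, ⟨y, hy, rfl⟩, hy2⟩ := exists_lt_of_csInf_lt ((hne i).image D)
      (show sInf (D '' C i) < R + η by linarith [hrR i])
    exact ⟨y, hy, hy2⟩
  have hAdir : Directed (· ⊇ ·) A := by
    rintro ⟨i, η, hη⟩ ⟨j, θ, hθ⟩
    obtain ⟨k, hki, hkj⟩ := hdir i j
    exact ⟨⟨k, min η θ, lt_min hη hθ⟩,
      fun y hy => ⟨hki hy.1, hy.2.trans_le (by simp)⟩,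
      fun y hy => ⟨hkj hy.1, hy.2.trans_le (by simp)⟩⟩
  let f : Filter X := ⨅ p, Filter.principal (A p)
  have hAf : ∀ p, A p ∈ f := fun p => Filter.mem_iInf_of_mem p (Filter.mem_principal_self _)
  have : Nonempty (ι × {η : ℝ // 0 < η}) := ⟨⟨i₀, 1, one_pos⟩⟩
  have hf : f.NeBot := by
    refine Filter.iInf_neBot_of_directed' ?_ fun p => Filter.principal_neBot_iff.2 (hAne p)
    intro p q
    obtain ⟨k, h1, h2⟩ := hAdir p q
    exact ⟨k, Filter.principal_mono.2 h1, Filter.principal_mono.2 h2⟩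
  have hcauchy : Cauchy f := by
    refine Metric.cauchy_iff.2 ⟨hf, fun ε hε => ?_⟩
    -- With `d = dist y y'`, convexity gives `(R - η) * (1 + d ^ 2 / 8) < R + η`. As `R - η ≥ R /
    -- 2`, this yields `R * d ^ 2 < 32 * η ≤ R * ε ^ 2 / 2`.
    set η := min (R / 2) (R * ε ^ 2 / 64) with hη
    have hR0 : 0 < R := hδ.trans_le hRδ
    have hη0 : 0 < η := lt_min (by positivity) (by positivity)
    obtain ⟨i, hi⟩ := exists_lt_of_lt_ciSup (show R - η < ⨆ i, r i by rw [← hR]; linarith)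
    refine ⟨A ⟨i, η, hη0⟩, hAf _, fun y hy y' hy' => ?_⟩
    have h1 := hD y y'
    have h2 := hr_le i _ (hmid i y hy.1 y' hy'.1)
    have h3 := one_add_sq_div_two_le_cosh (show 0 ≤ dist y y' / 2 by positivity)
    have h4 : D y < R + η := hy.2
    have h5 : D y' < R + η := hy'.2
    have h6 : η ≤ R / 2 := min_le_left _ _
    have h7 : η ≤ R * ε ^ 2 / 64 := min_le_right _ _
    have h8 : (R - η) * (1 + (dist y y' / 2) ^ 2 / 2) ≤
        D (mid y y') * Real.cosh (dist y y' / 2) :=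
      mul_le_mul (by linarith) h3 (by positivity) (by linarith)
    have h9 : (R / 2) * (dist y y') ^ 2 ≤ (R - η) * (dist y y') ^ 2 :=
      mul_le_mul_of_nonneg_right (by linarith) (sq_nonneg _)
    have h10 : R * dist y y' ^ 2 < R * ε ^ 2 := by
      have : 0 < R * ε ^ 2 := by positivity
      nlinarith
    exact lt_of_pow_lt_pow_left₀ 2 hε.le (lt_of_mul_lt_mul_left h10 hR0.le)
  obtain ⟨y, hy⟩ := CompleteSpace.complete hcauchy
  refine ⟨y, fun i => ?_⟩
  have : f.NeBot := hf
  exact (hclosed i).mem_of_tendsto (f := id) (b := f) hy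
    (Filter.mem_of_superset (hAf ⟨i, 1, one_pos⟩) fun y hy => hy.1)

/-! ### Kirszbraun's theorem for maps from the hyperbolic plane to `CAT(-1)` spaces -/

/-- A minimum of a function which is convex along geodesics in the sense of curvature `-1`. -/
theorem IsCATNegOne.cosh_mul_le_of_forall_le (hX : IsCATNegOne X) {J : Type*} [Fintype J]
    {lam : J → ℝ} (hlam : ∀ j, 0 ≤ lam j) (y : J → X) {m : X}
    (hm : ∀ z, ∑ j, lam j * Real.cosh (dist m (y j)) ≤ ∑ j, lam j * Real.cosh (dist z (y j)))
    (z : X) : Real.cosh (dist m z) * ∑ j, lam j * Real.cosh (dist m (y j)) ≤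
      ∑ j, lam j * Real.cosh (dist z (y j)) := by
  obtain ⟨c, hc⟩ := hX.geodesic m z
  set L := dist m z with hL
  set D : X → ℝ := fun x => ∑ j, lam j * Real.cosh (dist x (y j)) with hD
  change Real.cosh L * D m ≤ D z
  rcases (dist_nonneg (x := m) (y := z)).eq_or_lt with h0 | h0
  · have : m = z := dist_eq_zero.1 h0.symm
    rw [hL, ← h0, Real.cosh_zero, one_mul, this]
  have key : ∀ t ∈ Set.Icc 0 L, Real.sinh L * D (c t) ≤
      Real.sinh (L - t) * D m + Real.sinh t * D z := by
    intro t ht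
    simp only [hD, Finset.mul_sum, ← Finset.sum_add_distrib]
    refine Finset.sum_le_sum fun j _ => ?_
    have := mul_le_mul_of_nonneg_left (hX.sinh_mul_cosh_le hc (y j) ht) (hlam j)
    linarith
  -- The first-order condition at the minimum, without derivatives: compare `D m ≤ D (c (2 * u))`
  -- with convexity, divide by `2 * sinh u`, and let `u` tend to `0`.
  have key2 : ∀ u ∈ Set.Ioo 0 (L / 2), Real.cosh (L - u) * D m ≤ Real.cosh u * D z := by
    intro u hu
    have h1 := key (2 * u) ⟨by linarith [hu.1], by linarith [hu.2]⟩
    have hS : 0 < Real.sinh L := Real.sinh_pos_iff.2 h0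
    have h2 := mul_le_mul_of_nonneg_left (hm (c (2 * u))) hS.le
    have hs : 0 < Real.sinh u := Real.sinh_pos_iff.2 hu.1
    have e1 : Real.sinh L - Real.sinh (L - 2 * u) = 2 * Real.cosh (L - u) * Real.sinh u := by
      have h3 : ∀ p q : ℝ, Real.sinh (p + q) - Real.sinh (p - q) =
          2 * Real.cosh p * Real.sinh q := fun p q => by
        rw [Real.sinh_add, Real.sinh_sub]
        ring
      rw [← h3]
      ring_nf
    rw [Real.sinh_two_mul] at h1
    refine le_of_mul_le_mul_left ?_ hs
    have h3 : (Real.sinh L - Real.sinh (L - 2 * u)) * D m ≤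
        2 * Real.sinh u * Real.cosh u * D z := by
      have : Real.sinh L * D m ≤ Real.sinh L * D (c (2 * u)) := h2
      linarith
    rw [e1] at h3
    linarith
  have hev : ∀ᶠ u in nhdsWithin (0 : ℝ) (Set.Ioi 0),
      Real.cosh (L - u) * D m ≤ Real.cosh u * D z := by
    filter_upwards [Ioo_mem_nhdsGT (show (0 : ℝ) < L / 2 by positivity)] with u hu using key2 u hu
  have t1 : Filter.Tendsto (fun u => Real.cosh (L - u) * D m) (nhdsWithin (0 : ℝ) (Set.Ioi 0))
      (nhds (Real.cosh (L - 0) * D m)) :=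
    ((by fun_prop : Continuous fun u => Real.cosh (L - u) * D m).tendsto 0).mono_left
      nhdsWithin_le_nhds
  have t2 : Filter.Tendsto (fun u => Real.cosh u * D z) (nhdsWithin (0 : ℝ) (Set.Ioi 0))
      (nhds (Real.cosh 0 * D z)) :=
    ((by fun_prop : Continuous fun u => Real.cosh u * D z).tendsto 0).mono_left
      nhdsWithin_le_nhds
  simpa using le_of_tendsto_of_tendsto t1 t2 hev

/-- Let `m` minimize `D = ∑ λ_j cosh d(·, y_j)`. Then `cosh d(m, y_i) * D m ≤ D (y_i)`. Weighting by
`λ_i` and summing bounds `D m ^ 2` by `∑ λ_i λ_j cosh d(y_i, y_j)`. Shortness replaces `y` by `a`,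
and the reverse Cauchy-Schwarz inequality bounds the result by the square of the right-hand side. -/
theorem IsCATNegOne.exists_weighted_le [CompleteSpace X] (hX : IsCATNegOne X) {J : Type*}
    [Fintype J] {lam : J → ℝ} (hlam : ∀ j, 0 ≤ lam j) (hpos : 0 < ∑ j, lam j) {a : J → ℍ}
    {y : J → X} (h : ∀ i j, dist (y i) (y j) ≤ dist (a i) (a j)) (z : ℍ) :
    ∃ m, ∑ j, lam j * Real.cosh (dist m (y j)) ≤ ∑ j, lam j * Real.cosh (dist z (a j)) := by
  set D : X → ℝ := fun x => ∑ j, lam j * Real.cosh (dist x (y j)) with hD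
  have hJ : Nonempty J := by
    by_contra hJ
    rw [not_nonempty_iff] at hJ
    simp at hpos
  obtain ⟨j₀⟩ := hJ
  choose mid hmid using hX.exists_midpoint
  have hDmid : ∀ y y', 2 * Real.cosh (dist y y' / 2) * D (mid y y') ≤ D y + D y' := by
    intro x x'
    simp only [hD, Finset.mul_sum, ← Finset.sum_add_distrib]
    refine Finset.sum_le_sum fun j _ => ?_
    have := mul_le_mul_of_nonneg_left (hmid x x' (y j)) (hlam j)
    linarith
  have hδ : ∀ x, ∑ j, lam j ≤ D x := fun x => Finset.sum_le_sum fun j _ => by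
    have := mul_le_mul_of_nonneg_left (Real.one_le_cosh (dist x (y j))) (hlam j)
    linarith
  have hDmid' : ∀ x x' b, D x ≤ b → D x' ≤ b → D (mid x x') ≤ b := by
    intro x x' b hx hx'
    have h1 := hDmid x x'
    have h2 := Real.one_le_cosh (dist x x' / 2)
    have h3 := mul_le_mul_of_nonneg_right h2 (hpos.le.trans (hδ (mid x x')))
    linarith
  have hDcont : Continuous D := by
    simp only [hD]
    fun_prop
  have hbdd : BddBelow (Set.range D) := ⟨_, by rintro _ ⟨x, rfl⟩; exact hδ x⟩
  -- The minimum is a common point of the sublevel sets slightly above the infimum.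
  obtain ⟨m, hm⟩ := exists_forall_mem_of_midpoint
    (C := fun η : {η : ℝ // 0 < η} => {x | D x ≤ sInf (Set.range D) + η.1})
    (fun η θ => ⟨⟨min η.1 θ.1, lt_min η.2 θ.2⟩,
      fun x (hx : D x ≤ _) => hx.trans (by simp), fun x (hx : D x ≤ _) => hx.trans (by simp)⟩)
    (fun η => isClosed_le hDcont continuous_const)
    (fun η => by
      obtain ⟨_, ⟨x, rfl⟩, hx⟩ := exists_lt_of_csInf_lt (Set.range_nonempty_iff_nonempty.2 ⟨y j₀⟩)
        (show sInf (Set.range D) < sInf (Set.range D) + η.1 by linarith [η.2])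
      exact ⟨x, hx.le⟩)
    (fun η x hx x' hx' => hDmid' x x' _ hx hx') hDmid hpos hδ ⟨1, one_pos⟩ (fun x hx => hx)
  have hmin : ∀ x, D m ≤ D x := fun x => by
    refine le_trans ?_ (csInf_le hbdd ⟨x, rfl⟩)
    exact le_of_forall_pos_le_add fun ε hε => hm ⟨ε, hε⟩
  refine ⟨m, ?_⟩
  have h1 : D m ^ 2 ≤ (∑ j, lam j * Real.cosh (dist z (a j))) ^ 2 := by
    refine le_trans ?_ (sum_sum_cosh_le_sq Finset.univ lam a z)
    calc D m ^ 2 = ∑ i, lam i * (Real.cosh (dist m (y i)) * D m) := by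
          rw [sq]
          conv_lhs => enter [1]; rw [hD]
          rw [Finset.sum_mul]
          exact Finset.sum_congr rfl fun i _ => by ring
      _ ≤ ∑ i, lam i * D (y i) := Finset.sum_le_sum fun i _ =>
          mul_le_mul_of_nonneg_left (hX.cosh_mul_le_of_forall_le hlam y hmin (y i)) (hlam i)
      _ = ∑ i, ∑ j, lam i * lam j * Real.cosh (dist (y i) (y j)) := by
          simp only [hD, Finset.mul_sum, mul_assoc]
      _ ≤ _ := Finset.sum_le_sum fun i _ => Finset.sum_le_sum fun j _ =>
          mul_le_mul_of_nonneg_left (cosh_dist_le_cosh_dist.2 (h i j))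
            (mul_nonneg (hlam i) (hlam j))
  refine le_of_sq_le_sq h1 (Finset.sum_nonneg fun j _ => mul_nonneg (hlam j) (Real.cosh_pos _).le)

/-- Replaces the hyperbolic weights `sinh (θ * L) / sinh L` by the larger affine weights `θ`. The
set to be shown convex below is upward closed and tolerates this loss. -/
theorem sinh_mul_le {θ L : ℝ} (hθ : θ ∈ Set.Icc 0 1) (hL : 0 ≤ L) :
    Real.sinh (θ * L) ≤ θ * Real.sinh L := by
  have h1 : ConvexOn ℝ (Set.Ici 0) Real.sinh := by
    refine MonotoneOn.convexOn_of_deriv (convex_Ici 0) Real.continuous_sinh.continuousOn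
      Real.differentiable_sinh.differentiableOn ?_
    rw [interior_Ici, Real.deriv_sinh]
    exact Real.cosh_strictMonoOn.monotoneOn.mono Set.Ioi_subset_Ici_self
  have h2 := h1.2 (Set.mem_Ici.2 hL) (Set.mem_Ici.2 le_rfl) hθ.1 (sub_nonneg.2 hθ.2) (by ring)
  simpa using h2

/-- Duality. If no `m` works, the convex set `V` of vectors dominating some `(cosh d(x, y_j))_j`
misses the open orthant `W`, and a linear functional separates them. Its weights are nonnegative
because `V` is upward closed, so `exists_weighted_le` contradicts the separation. -/
theorem IsCATNegOne.exists_forall_cosh_le_add [CompleteSpace X] [Nonempty X] (hX : IsCATNegOne X)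
    {J : Type*} [Fintype J] {a : J → ℍ} {y : J → X}
    (h : ∀ i j, dist (y i) (y j) ≤ dist (a i) (a j)) (z : ℍ) {ε : ℝ} (hε : 0 < ε) :
    ∃ m, ∀ j, Real.cosh (dist m (y j)) ≤ Real.cosh (dist z (a j)) + ε := by
  classical
  by_contra! hcon
  let V : Set (J → ℝ) := {v | ∃ x, ∀ j, Real.cosh (dist x (y j)) ≤ v j}
  let W : Set (J → ℝ) := Set.univ.pi fun j => Set.Iio (Real.cosh (dist z (a j)) + ε)
  have hW : IsOpen W := isOpen_set_pi Set.finite_univ fun j _ => isOpen_Iio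
  have hWc : Convex ℝ W := convex_pi fun j _ => convex_Iio _
  have hVc : Convex ℝ V := by
    rintro v ⟨x, hx⟩ v' ⟨x', hx'⟩ α β hα hβ hαβ
    obtain ⟨c, hc⟩ := hX.geodesic x x'
    rcases (dist_nonneg (x := x) (y := x')).eq_or_lt with h0 | h0
    · have hxx : x = x' := dist_eq_zero.1 h0.symm
      subst hxx
      refine ⟨x, fun j => ?_⟩
      have h1 := mul_le_mul_of_nonneg_left (hx j) hα
      have h2 := mul_le_mul_of_nonneg_left (hx' j) hβ
      have h3 : Real.cosh (dist x (y j)) =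
        α * Real.cosh (dist x (y j)) + β * Real.cosh (dist x (y j)) := by rw [← add_mul, hαβ, one_mul]
      simp only [Pi.add_apply, Pi.smul_apply, smul_eq_mul]
      linarith
    · have hβ1 : β ≤ 1 := by linarith
      have hα1 : α ≤ 1 := by linarith
      refine ⟨c (β * dist x x'), fun j => ?_⟩
      have h1 := hX.sinh_mul_cosh_le hc (y j) (s := β * dist x x')
        ⟨by positivity, mul_le_of_le_one_left h0.le hβ1⟩
      have h2 := sinh_mul_le ⟨hβ, hβ1⟩ h0.le
      have h3 := sinh_mul_le ⟨hα, hα1⟩ h0.le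
      rw [show dist x x' - β * dist x x' = α * dist x x' by
        rw [eq_sub_of_add_eq hαβ]; ring] at h1
      have h4 := mul_le_mul h2 (hx' j) (Real.cosh_pos _).le
        (mul_nonneg hβ (Real.sinh_pos_iff.2 h0).le)
      have h5 := mul_le_mul h3 (hx j) (Real.cosh_pos _).le
        (mul_nonneg hα (Real.sinh_pos_iff.2 h0).le)
      simp only [Pi.add_apply, Pi.smul_apply, smul_eq_mul]
      refine le_of_mul_le_mul_left ?_ (Real.sinh_pos_iff.2 h0)
      linarith
  have hdisj : Disjoint W V := by
    rw [Set.disjoint_left]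
    rintro v hv ⟨x, hx⟩
    obtain ⟨j, hj⟩ := hcon x
    have h1 : v j < Real.cosh (dist z (a j)) + ε := hv j (Set.mem_univ j)
    linarith [hx j]
  obtain ⟨f, u, hf1, hf2⟩ := geometric_hahn_banach_open hWc hW hVc hdisj
  set lam : J → ℝ := fun j => f (Pi.single j 1) with hlam
  have hf : ∀ v : J → ℝ, f v = ∑ j, lam j * v j := by
    intro v
    have h1 := pi_eq_sum_univ' v
    conv_lhs => rw [h1]
    rw [map_sum]
    refine Finset.sum_congr rfl fun j _ => ?_
    rw [map_smul, smul_eq_mul, mul_comm]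
  obtain ⟨x₀⟩ := ‹Nonempty X›
  have hlam0 : ∀ j, 0 ≤ lam j := by
    intro j
    by_contra! hneg
    have h1 : ∀ n : ℝ, 0 ≤ n → u ≤ f (fun i => Real.cosh (dist x₀ (y i))) + n * lam j := by
      intro n hn
      have h2 := hf2 ((fun i => Real.cosh (dist x₀ (y i))) + n • Pi.single j 1) ⟨x₀, fun i => by
        have : 0 ≤ (Pi.single j (1 : ℝ) : J → ℝ) i := by
          rw [Pi.single_apply]; split_ifs <;> norm_num
        simp only [Pi.add_apply, Pi.smul_apply, smul_eq_mul]
        have := mul_nonneg hn this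
        linarith⟩
      rwa [map_add, map_smul, smul_eq_mul] at h2
    set b := f (fun i => Real.cosh (dist x₀ (y i)))
    have h3 := h1 0 le_rfl
    -- This multiple brings the right-hand side of `h1` down to `u - 1`.
    have h4 := h1 ((b - u + 1) / (-lam j)) (div_nonneg (by linarith) (by linarith))
    rw [div_mul_eq_mul_div, div_neg, mul_div_assoc, div_self hneg.ne] at h4
    linarith
  have hlt := hf1 (fun j => Real.cosh (dist z (a j))) fun j _ => by
    change Real.cosh (dist z (a j)) < _
    linarith
  rw [hf] at hlt
  -- If all weights vanish, the functional is zero and the separation reads `0 < u ≤ 0`.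
  rcases (Finset.sum_nonneg fun j (_ : j ∈ Finset.univ) => hlam0 j).eq_or_lt with h0 | h0
  · have h1 := (Finset.sum_eq_zero_iff_of_nonneg fun j _ => hlam0 j).1 h0.symm
    have h2 := hf2 _ ⟨x₀, fun j => le_rfl⟩
    rw [hf, Finset.sum_eq_zero fun j hj => by rw [h1 j hj, zero_mul]] at h2
    rw [Finset.sum_eq_zero fun j hj => by rw [h1 j hj, zero_mul]] at hlt
    linarith
  · obtain ⟨m, hm⟩ := hX.exists_weighted_le hlam0 h0 h z
    have h2 := hf2 _ ⟨m, fun j => le_rfl⟩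
    rw [hf] at h2
    linarith

/-- Short maps from a subset of the hyperbolic plane can be extended to one more point. -/
theorem IsCATNegOne.exists_forall_dist_le [CompleteSpace X] (hX : IsCATNegOne X) {J : Type*}
    [Nonempty J] {a : J → ℍ} {y : J → X} (h : ∀ i j, dist (y i) (y j) ≤ dist (a i) (a j)) (z : ℍ) :
    ∃ m, ∀ j, dist m (y j) ≤ dist z (a j) := by
  classical
  obtain ⟨j₀⟩ := ‹Nonempty J›
  have : Nonempty X := ⟨y j₀⟩
  choose mid hmid using hX.exists_midpoint
  -- The sets are indexed by a finite set of constraints and a slack. The finite approximate version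
  -- makes each nonempty, and one constraint `j₀` already bounds the convex function.
  obtain ⟨m, hm⟩ := exists_forall_mem_of_midpoint
    (C := fun p : Finset J × {η : ℝ // 0 < η} =>
      {x | ∀ j ∈ p.1, Real.cosh (dist x (y j)) ≤ Real.cosh (dist z (a j)) + p.2.1})
    (mid := mid) (D := fun x => Real.cosh (dist x (y j₀))) (δ := 1)
    (B := Real.cosh (dist z (a j₀)) + 1)
    (fun p q => ⟨⟨p.1 ∪ q.1, min p.2.1 q.2.1, lt_min p.2.2 q.2.2⟩,
      fun x hx j hj => (hx j (Finset.mem_union_left _ hj)).trans (by simp),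
      fun x hx j hj => (hx j (Finset.mem_union_right _ hj)).trans (by simp)⟩)
    (fun p => by
      have : {x | ∀ j ∈ p.1, Real.cosh (dist x (y j)) ≤ Real.cosh (dist z (a j)) + p.2.1} =
          ⋂ j ∈ p.1, {x | Real.cosh (dist x (y j)) ≤ Real.cosh (dist z (a j)) + p.2.1} := by
        ext x; simp
      rw [this]
      exact isClosed_biInter fun j _ => isClosed_le (by fun_prop) continuous_const)
    (fun p => by
      obtain ⟨m, hm⟩ := hX.exists_forall_cosh_le_add (J := p.1) (a := fun j => a j)
        (y := fun j => y j) (fun i j => h i j) z p.2.2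
      exact ⟨m, fun j hj => hm ⟨j, hj⟩⟩)
    (fun p x hx x' hx' j hj => by
      have h1 := hmid x x' (y j)
      have h2 := mul_le_mul_of_nonneg_right (Real.one_le_cosh (dist x x' / 2))
        (Real.cosh_pos (dist (mid x x') (y j))).le
      linarith [hx j hj, hx' j hj])
    (fun x x' => hmid x x' (y j₀)) one_pos (fun x => Real.one_le_cosh _) ⟨{j₀}, 1, one_pos⟩
    (fun x hx => hx j₀ (Finset.mem_singleton_self _))
  refine ⟨m, fun j => cosh_dist_le_cosh_dist.1 ?_⟩
  exact le_of_forall_pos_le_add fun ε hε => hm ⟨{j}, ε, hε⟩ j (Finset.mem_singleton_self _)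

/-- **Kirszbraun's theorem** for maps from subsets of the hyperbolic plane (given by their graphs)
to complete `CAT(-1)` spaces. -/
theorem IsCATNegOne.exists_lipschitz_extension [CompleteSpace X] (hX : IsCATNegOne X)
    {R : Set (ℍ × X)} (hne : R.Nonempty) (hR : ∀ p ∈ R, ∀ q ∈ R, dist p.2 q.2 ≤ dist p.1 q.1) :
    ∃ h : ℍ → X, LipschitzWith 1 h ∧ ∀ p ∈ R, h p.1 = p.2 := by
  -- Short partial maps are treated as relations: the distance inequality makes a relation
  -- single-valued, so a maximal one is the graph of a map once its domain is shown to be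
  -- everything.
  obtain ⟨M, hRM, hM⟩ := zorn_subset_nonempty
    {R : Set (ℍ × X) | ∀ p ∈ R, ∀ q ∈ R, dist p.2 q.2 ≤ dist p.1 q.1} (by
      intro c hc hchain _
      refine ⟨⋃₀ c, ?_, fun s hs => Set.subset_sUnion_of_mem hs⟩
      rintro p ⟨s, hs, hp⟩ q ⟨t, ht, hq⟩
      rcases hchain.total hs ht with hst | hst
      · exact hc ht p (hst hp) q hq
      · exact hc hs p hp q (hst hq)) R hR
  have hdom : ∀ z, ∃ y, (z, y) ∈ M := by
    intro z
    have : Nonempty M := (hne.mono hRM).to_subtype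
    obtain ⟨y, hy⟩ := hX.exists_forall_dist_le (J := M) (a := fun p => p.1.1) (y := fun p => p.1.2)
      (fun p q => hM.prop p.1 p.2 q.1 q.2) z
    refine ⟨y, ?_⟩
    have : insert (z, y) M ⊆ M := hM.le_of_ge (y := insert (z, y) M) (by
      rintro p (rfl | hp) q (rfl | hq)
      · simp
      · exact hy ⟨q, hq⟩
      · rw [dist_comm, dist_comm p.1]
        exact hy ⟨p, hp⟩
      · exact hM.prop p hp q hq) (Set.subset_insert _ _)
    exact this (Set.mem_insert _ _)
  choose h hh using hdom
  refine ⟨h, LipschitzWith.of_dist_le_mul fun z w => ?_, fun p hp => ?_⟩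
  · simpa using hM.prop _ (hh z) _ (hh w)
  · have := hM.prop _ (hh p.1) p (hRM hp)
    rw [dist_self] at this
    exact dist_le_zero.1 this

/-- A comparison triangle can be mapped to a `CAT(-1)` space by a `1`-Lipschitz map which extends
the comparison map of the sides. -/
theorem IsCATNegOne.exists_comparison_map [CompleteSpace X] (hX : IsCATNegOne X) {x : Fin 3 → X}
    {a : Fin 3 → ℍ} (ha : ∀ i j, dist (a i) (a j) = dist (x i) (x j)) :
    ∃ h : ℍ → X, LipschitzWith 1 h ∧ ∀ i j c, IsGeodesicFromTo c (x i) (x j) →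
      ∀ z ∈ hypSegment (a i) (a j), h z = c (dist (a i) z) := by
  -- All geodesics between the vertices are recorded at once, so shortness of the relation includes
  -- their uniqueness.
  let P : Fin 3 → Fin 3 → ℍ × X → Prop := fun i j p =>
    ∃ c, IsGeodesicFromTo c (x i) (x j) ∧ p.1 ∈ hypSegment (a i) (a j) ∧ p.2 = c (dist (a i) p.1)
  have hsymm : ∀ i j p, P i j p → P j i p := by
    rintro i j p ⟨c, hc, hp, hp2⟩
    refine ⟨_, hc.symm, by rwa [hypSegment_comm], ?_⟩
    rw [hp2]
    congr 1
    have : dist (a i) p.1 + dist p.1 (a j) = dist (a i) (a j) := hp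
    rw [← ha, dist_comm (a j)]
    linarith
  -- A constant side is a vertex and may be moved to any side through it.
  have hdeg : ∀ i k p, P i i p → P i k p := by
    rintro i k p ⟨c, hc, hp, hp2⟩
    obtain ⟨c', hc'⟩ := hX.geodesic (x i) (x k)
    rw [hypSegment_self] at hp
    refine ⟨c', hc', ?_, ?_⟩
    · rw [hp]
      exact left_mem_hypSegment _ _
    · rw [hp2, hp, dist_self, hc.source, hc'.source]
  have hcomp : ∀ i j k p q, P i j p → P i k q → dist p.2 q.2 ≤ dist p.1 q.1 := by
    rintro i j k p q ⟨c, hc, hp, hp2⟩ ⟨c', hc', hq, hq2⟩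
    have hp' : dist (a i) p.1 + dist p.1 (a j) = dist (a i) (a j) := hp
    have hq' : dist (a i) q.1 + dist q.1 (a k) = dist (a i) (a k) := hq
    rw [hp2, hq2]
    exact hX.comparison _ _ _ c c' hc hc' (a i) (a j) (a k) (ha i j) (ha i k) (ha j k) _
      ⟨dist_nonneg, by rw [← ha]; linarith [dist_nonneg (x := p.1) (y := a j)]⟩ _
      ⟨dist_nonneg, by rw [← ha]; linarith [dist_nonneg (x := q.1) (y := a k)]⟩ _ hp _ hq rfl rfl
  obtain ⟨h, h1, h2⟩ := hX.exists_lipschitz_extension (R := {p | ∃ i j, P i j p}) (by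
    obtain ⟨c, hc⟩ := hX.geodesic (x 0) (x 0)
    exact ⟨(a 0, c (dist (a 0) (a 0))), 0, 0, c, hc, left_mem_hypSegment _ _, rfl⟩) (by
    rintro p ⟨i, j, hp⟩ q ⟨k, l, hq⟩
    by_cases hij : i = j
    · subst hij
      exact hcomp k i l p q (hsymm _ _ _ (hdeg _ k _ hp)) hq
    by_cases hkl : k = l
    · subst hkl
      exact hcomp i j k p q hp (hsymm _ _ _ (hdeg _ i _ hq))
    -- Two genuine sides of a triangle share a vertex, at which the comparison inequality applies.
    have : i = k ∨ i = l ∨ j = k ∨ j = l := by omega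
    rcases this with rfl | rfl | rfl | rfl
    · exact hcomp _ _ _ _ _ hp hq
    · exact hcomp _ _ _ _ _ hp (hsymm _ _ _ hq)
    · exact hcomp _ _ _ _ _ (hsymm _ _ _ hp) hq
    · exact hcomp _ _ _ _ _ (hsymm _ _ _ hp) (hsymm _ _ _ hq))
  exact ⟨h, h1, fun i j c hc z hz => h2 (z, c (dist (a i) z)) ⟨i, j, c, hc, hz, rfl⟩⟩

end Kirszbraun

/-! ### Systems of faces and their canonical maps -/

section FaceSystem

open Topology

variable {M : Type u} [TopologicalSpace M]

/-- The properties of (possibly infinite) triangulations used to compare a space with the space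
glued from hyperbolic triangles. -/
structure IsFaceSystem (𝓕 : Set C(stdSimplex ℝ (Fin 3), M)) : Prop where
  cover : ∀ x, ∃ q : 𝓕 × stdSimplex ℝ (Fin 3), q.1.1 q.2 = x
  overlap : ∀ (f f' : 𝓕) t t', f.1 t = f'.1 t' → (f = f' ∧ t = t') ∨
    (∃ i k, t = stdSimplex.vertex i ∧ t' = stdSimplex.vertex k) ∨
    ∃ i j k l s, i ≠ j ∧ side f.1 i j = side f'.1 k l ∧ t = stdSimplex.map ![i, j] s ∧
      t' = stdSimplex.map ![k, l] s
  finite_fiber : ∀ x, {q : 𝓕 × stdSimplex ℝ (Fin 3) | q.1.1 q.2 = x}.Finite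
  star_mem : ∀ x (W : 𝓕 × stdSimplex ℝ (Fin 3) → Set (stdSimplex ℝ (Fin 3))),
    (∀ q, q.1.1 q.2 = x → W q ∈ 𝓝 q.2) →
      {y | ∃ q : 𝓕 × stdSimplex ℝ (Fin 3), q.1.1 q.2 = x ∧ ∃ w ∈ W q, q.1.1 w = y} ∈ 𝓝 x

/-- `ℓ` consists of side lengths of hyperbolic triangles which agree on common sides. -/
structure IsLengthFunction {𝓕 : Set C(stdSimplex ℝ (Fin 3), M)}
    (ℓ : 𝓕 → Fin 3 → Fin 3 → ℝ) : Prop where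
  realized : ∀ f i j, dist (triangleOfLengths (ℓ f) i) (triangleOfLengths (ℓ f) j) = ℓ f i j
  side_congr : ∀ (f f' : 𝓕) i j k l, side f.1 i j = side f'.1 k l → ℓ f i j = ℓ f' k l

variable {𝓕 : Set C(stdSimplex ℝ (Fin 3), M)} {ℓ : 𝓕 → Fin 3 → Fin 3 → ℝ}

theorem side_apply (f : C(stdSimplex ℝ (Fin 3), M)) (i j : Fin 3) (s : stdSimplex ℝ (Fin 2)) :
    side f i j s = f (stdSimplex.map ![i, j] s) := rfl

theorem map_const_eq_vertex (i : Fin 3) (s : stdSimplex ℝ (Fin 2)) :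
    stdSimplex.map ![i, i] s = stdSimplex.vertex i := by
  have h : (![i, i] : Fin 2 → Fin 3) = fun _ => i := by
    funext k
    fin_cases k <;> rfl
  refine stdSimplex.ext (funext fun j => ?_)
  rw [stdSimplex.map_coe, FunOnFinite.linearMap_apply_apply, stdSimplex.vertex_coe, h]
  by_cases hij : i = j
  · subst hij
    simp
  · simp [hij]

theorem side_self (f : C(stdSimplex ℝ (Fin 3), M)) (i : Fin 3) (s : stdSimplex ℝ (Fin 2)) :
    side f i i s = f (stdSimplex.vertex i) := by
  rw [side_apply, map_const_eq_vertex]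

/-- The point of `Δ_f` with given barycentric coordinates. -/
def facePt (ℓ : 𝓕 → Fin 3 → Fin 3 → ℝ) (f : 𝓕) (t : stdSimplex ℝ (Fin 3)) : FacePoint 𝓕 ℓ :=
  ⟨f, bary (triangleOfLengths (ℓ f)) t, mem_hypTriangle_iff_bary.2 ⟨t, rfl⟩⟩

theorem exists_facePt_eq (x : FacePoint 𝓕 ℓ) : ∃ t, facePt ℓ x.face t = x := by
  obtain ⟨f, z, hz⟩ := x
  obtain ⟨t, rfl⟩ := mem_hypTriangle_iff_bary.1 hz
  exact ⟨t, rfl⟩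

theorem onSide_facePt (f : 𝓕) (i j : Fin 3) (s : stdSimplex ℝ (Fin 2)) :
    (facePt ℓ f (stdSimplex.map ![i, j] s)).OnSide i j :=
  mem_hypSegment_iff_bary.2 ⟨s, rfl⟩

theorem exists_facePt_eq_of_onSide {x : FacePoint 𝓕 ℓ} {i j : Fin 3} (h : x.OnSide i j) :
    ∃ s, facePt ℓ x.face (stdSimplex.map ![i, j] s) = x := by
  obtain ⟨f, z, hz⟩ := x
  obtain ⟨s, hs⟩ := mem_hypSegment_iff_bary.1 h
  refine ⟨s, ?_⟩
  simp only at hs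
  subst hs
  rfl

theorem IsLengthFunction.dist_side (hℓ : IsLengthFunction ℓ) {f f' : 𝓕} {i j k l : Fin 3}
    (h : side f.1 i j = side f'.1 k l) (s : stdSimplex ℝ (Fin 2)) :
    dist (triangleOfLengths (ℓ f) i) (bary (triangleOfLengths (ℓ f)) (stdSimplex.map ![i, j] s)) =
      dist (triangleOfLengths (ℓ f') k)
        (bary (triangleOfLengths (ℓ f')) (stdSimplex.map ![k, l] s)) := by
  have h1 := hℓ.side_congr f f' i j k l h
  rw [← hℓ.realized, ← hℓ.realized] at h1
  have h2 := dist_bary_congr (a := triangleOfLengths (ℓ f) ∘ ![i, j])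
    (b := triangleOfLengths (ℓ f') ∘ ![k, l]) (fun m n => by
      fin_cases m <;> fin_cases n <;> simp [h1]
      rw [dist_comm, h1, dist_comm]) (stdSimplex.vertex 0) s
  rw [bary_vertex, bary_vertex, ← bary_map, ← bary_map] at h2
  exact h2

theorem IsLengthFunction.glued_facePt (hℓ : IsLengthFunction ℓ) {f f' : 𝓕} {i j k l : Fin 3}
    (h : side f.1 i j = side f'.1 k l) (s : stdSimplex ℝ (Fin 2)) :
    Glued (facePt ℓ f (stdSimplex.map ![i, j] s)) (facePt ℓ f' (stdSimplex.map ![k, l] s)) :=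
  ⟨i, j, k, l, h, onSide_facePt f i j s, onSide_facePt f' k l s, hℓ.dist_side h s⟩

theorem edist_mk_le_of_chain {x y : FacePoint 𝓕 ℓ} {L : ℝ≥0∞} (h : Chain x y L) :
    edist (Cone.mk x) (Cone.mk y) ≤ L := sInf_le h

theorem Glued.mk_eq {x y : FacePoint 𝓕 ℓ} (h : Glued x y) : Cone.mk x = Cone.mk y :=
  edist_le_zero.1 (edist_mk_le_of_chain (Chain.refl.glue h))

theorem edist_mk_le {x y : FacePoint 𝓕 ℓ} (h : x.face = y.face) :
    edist (Cone.mk x) (Cone.mk y) ≤ edist x.pt y.pt := by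
  have := edist_mk_le_of_chain (Chain.refl.move h)
  rwa [zero_add] at this

theorem exists_chain_of_edist_lt {x y : FacePoint 𝓕 ℓ} {r : ℝ≥0∞}
    (h : edist (Cone.mk x) (Cone.mk y) < r) : ∃ L < r, Chain x y L := by
  obtain ⟨L, hL, hLr⟩ := sInf_lt_iff.1 (show sInf {L | Chain x y L} < r from h)
  exact ⟨L, hLr, hL⟩

theorem IsFaceSystem.mk_facePt_eq (h𝓕 : IsFaceSystem 𝓕) (hℓ : IsLengthFunction ℓ) {f f' : 𝓕}
    {t t' : stdSimplex ℝ (Fin 3)} (h : f.1 t = f'.1 t') :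
    Cone.mk (facePt ℓ f t) = Cone.mk (facePt ℓ f' t') := by
  rcases h𝓕.overlap f f' t t' h with ⟨rfl, rfl⟩ | ⟨i, k, rfl, rfl⟩ | ⟨i, j, k, l, s, -, h1, rfl, rfl⟩
  · rfl
  · have h1 : side f.1 i i = side f'.1 k k := by
      ext s
      rw [side_self, side_self, h]
    have := (hℓ.glued_facePt h1 (stdSimplex.vertex 0)).mk_eq
    rwa [map_const_eq_vertex, map_const_eq_vertex] at this
  · exact (hℓ.glued_facePt h1 s).mk_eq

/-- The canonical map to the glued space, given on every face by barycentric coordinates. -/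
def IsFaceSystem.toCone (h𝓕 : IsFaceSystem 𝓕) (ℓ : 𝓕 → Fin 3 → Fin 3 → ℝ) (x : M) : Cone 𝓕 ℓ :=
  Cone.mk (facePt ℓ (h𝓕.cover x).choose.1 (h𝓕.cover x).choose.2)

theorem IsFaceSystem.toCone_apply (h𝓕 : IsFaceSystem 𝓕) (hℓ : IsLengthFunction ℓ) (f : 𝓕)
    (t : stdSimplex ℝ (Fin 3)) : h𝓕.toCone ℓ (f.1 t) = Cone.mk (facePt ℓ f t) :=
  h𝓕.mk_facePt_eq hℓ (h𝓕.cover (f.1 t)).choose_spec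

/-- Points near `x` lie, on some face, near a preimage of `x`, and the glued distance is at most the
distance in that triangle. -/
theorem IsFaceSystem.continuous_toCone (h𝓕 : IsFaceSystem 𝓕) (hℓ : IsLengthFunction ℓ) :
    Continuous (h𝓕.toCone ℓ) := by
  refine continuous_iff_continuousAt.2 fun x => EMetric.tendsto_nhds.2 fun ε hε => ?_
  have h1 : ∀ q : 𝓕 × stdSimplex ℝ (Fin 3), {w | edist (bary (triangleOfLengths (ℓ q.1)) w)
      (bary (triangleOfLengths (ℓ q.1)) q.2) < ε} ∈ 𝓝 q.2 := fun q =>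
    EMetric.tendsto_nhds.1 ((continuous_bary (triangleOfLengths (ℓ q.1))).tendsto q.2) ε hε
  filter_upwards [h𝓕.star_mem x _ fun q _ => h1 q] with y hy
  obtain ⟨q, hq, w, hw, rfl⟩ := hy
  have h2 : edist (Cone.mk (facePt ℓ q.1 w)) (Cone.mk (facePt ℓ q.1 q.2)) ≤
      edist (bary (triangleOfLengths (ℓ q.1)) w) (bary (triangleOfLengths (ℓ q.1)) q.2) :=
    edist_mk_le rfl
  rw [← h𝓕.toCone_apply hℓ, ← h𝓕.toCone_apply hℓ, hq] at h2
  exact h2.trans_lt hw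

theorem IsFaceSystem.surjective_toCone (h𝓕 : IsFaceSystem 𝓕) (hℓ : IsLengthFunction ℓ) :
    Function.Surjective (h𝓕.toCone ℓ) := by
  intro c
  obtain ⟨x, rfl⟩ := SeparationQuotient.surjective_mk c
  obtain ⟨t, ht⟩ := exists_facePt_eq x
  refine ⟨x.face.1 t, ?_⟩
  rw [h𝓕.toCone_apply hℓ, ht]
  rfl

theorem IsFaceSystem.respectsFaces_toCone (h𝓕 : IsFaceSystem 𝓕) (hℓ : IsLengthFunction ℓ) :
    RespectsFaces (h𝓕.toCone ℓ) := by
  refine fun f => ⟨?_, fun i j => ?_⟩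
  · ext c
    constructor
    · rintro ⟨_, ⟨t, rfl⟩, rfl⟩
      exact ⟨facePt ℓ f t, rfl, (h𝓕.toCone_apply hℓ f t).symm⟩
    · rintro ⟨x, rfl, rfl⟩
      obtain ⟨t, ht⟩ := exists_facePt_eq x
      exact ⟨x.face.1 t, ⟨t, rfl⟩, by rw [h𝓕.toCone_apply hℓ, ht]⟩
  · ext c
    constructor
    · rintro ⟨_, ⟨s, rfl⟩, rfl⟩
      exact ⟨facePt ℓ f (stdSimplex.map ![i, j] s), rfl, onSide_facePt f i j s,
        (h𝓕.toCone_apply hℓ f _).symm⟩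
    · rintro ⟨x, rfl, hx, rfl⟩
      obtain ⟨s, hs⟩ := exists_facePt_eq_of_onSide hx
      exact ⟨side x.face.1 i j s, ⟨s, rfl⟩, by rw [side_apply, h𝓕.toCone_apply hℓ, hs]⟩

theorem IsLengthFunction.injective_bary (hℓ : IsLengthFunction ℓ) (hnd : NonDegenerate ℓ) (f : 𝓕) :
    Function.Injective (bary (triangleOfLengths (ℓ f))) :=
  _root_.injective_bary (linearIndependent_hvec fun i j k hij hjk hik => by
    simpa only [hℓ.realized] using hnd f i j k hij hjk hik)

/-- Points of the glued space close to a given point are represented in a given neighborhood. -/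
theorem IsFaceSystem.exists_forall_edist_toCone_lt (h𝓕 : IsFaceSystem 𝓕)
    (hℓ : IsLengthFunction ℓ) (hnd : NonDegenerate ℓ) (x : M) {U : Set M} (hU : U ∈ 𝓝 x) :
    ∃ r > 0, ∀ y, edist (h𝓕.toCone ℓ x) (h𝓕.toCone ℓ y) < r → y ∈ U := by
  set b : (f : 𝓕) → stdSimplex ℝ (Fin 3) → ℍ := fun f => bary (triangleOfLengths (ℓ f))
  have hbc : ∀ f, Continuous (b f) := fun f => continuous_bary _
  have hbi : ∀ f, Function.Injective (b f) := fun f => hℓ.injective_bary hnd f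
  -- For every preimage of `x` in a face, a small radius has two properties: the ball in the
  -- triangle is carried into `U`, and a side meeting the ball contains the preimage. Finiteness of
  -- the fibre makes the radius uniform.
  have h1 : ∀ q ∈ {q : 𝓕 × stdSimplex ℝ (Fin 3) | q.1.1 q.2 = x}, ∀ᶠ r in 𝓝[>] (0 : ℝ),
      (∀ w, dist (b q.1 w) (b q.1 q.2) < r → q.1.1 w ∈ U) ∧
      ∀ i j, ∀ z ∈ hypSegment (triangleOfLengths (ℓ q.1) i) (triangleOfLengths (ℓ q.1) j),
        dist z (b q.1 q.2) < r →
        b q.1 q.2 ∈ hypSegment (triangleOfLengths (ℓ q.1) i) (triangleOfLengths (ℓ q.1) j) := by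
    rintro ⟨f, t⟩ hq
    refine Filter.Eventually.and ?_ ?_
    · have hemb := ((hbc f).isClosedEmbedding (hbi f)).isInducing
      have hU' : f.1 ⁻¹' U ∈ 𝓝 t := f.1.continuous.continuousAt (by rwa [show f.1 t = x from hq])
      rw [hemb.nhds_eq_comap, Filter.mem_comap] at hU'
      obtain ⟨V, hV, hVU⟩ := hU'
      obtain ⟨ε, hε, hεV⟩ := Metric.mem_nhds_iff.1 hV
      filter_upwards [Ioo_mem_nhdsGT hε] with r hr w hw
      exact hVU (hεV (hw.trans hr.2))
    · refine Filter.eventually_all.2 fun i => Filter.eventually_all.2 fun j => ?_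
      by_cases h : b f t ∈ hypSegment (triangleOfLengths (ℓ f) i) (triangleOfLengths (ℓ f) j)
      · exact Filter.Eventually.of_forall fun r z _ _ => h
      · obtain ⟨ε, hε, hεV⟩ := Metric.mem_nhds_iff.1
          ((isClosed_hypSegment _ _).isOpen_compl.mem_nhds h)
        filter_upwards [Ioo_mem_nhdsGT hε] with r hr z hz hzr
        exact absurd hz (hεV (hzr.trans hr.2))
  obtain ⟨r, hr, hr0⟩ := (((Filter.eventually_all_finite (h𝓕.finite_fiber x)).2 h1).and
    self_mem_nhdsWithin).exists
  have hr0 : 0 < r := hr0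
  -- Invariant of a chain of length `L < r`: its end is within `L` of a preimage of `x` in its own
  -- face. When a side is crossed, that preimage lies on the side too, and its counterpart in the
  -- next face is again a preimage at the same distance.
  have key : ∀ (q₀ : 𝓕 × stdSimplex ℝ (Fin 3)) (y : FacePoint 𝓕 ℓ) (L : ℝ≥0∞), q₀.1.1 q₀.2 = x →
      Chain (facePt ℓ q₀.1 q₀.2) y L → L < ENNReal.ofReal r →
      ∃ q : 𝓕 × stdSimplex ℝ (Fin 3), q.1.1 q.2 = x ∧ q.1 = y.face ∧
        edist y.pt (b q.1 q.2) ≤ L := by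
    intro q₀ y L hq₀ hch
    induction hch with
    | refl => exact fun _ => ⟨q₀, hq₀, rfl, (edist_self _).le⟩
    | @move y z L _ hf ih =>
      intro hL
      obtain ⟨q, hq, hqy, hd⟩ := ih (lt_of_le_of_lt le_self_add hL)
      refine ⟨q, hq, hqy.trans hf, ?_⟩
      rw [add_comm]
      refine (edist_triangle _ y.pt _).trans (add_le_add ?_ hd)
      rw [edist_comm]
    | @glue y z L _ hg ih =>
      intro hL
      obtain ⟨⟨f, t⟩, hq, hqy, hd⟩ := ih hL
      obtain ⟨i, j, k, l, hs, hy, hz, hdist⟩ := hg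
      simp only at hqy hd
      subst hqy
      have hlt : dist y.pt (b y.face t) < r := by
        rw [← ENNReal.ofReal_lt_ofReal_iff hr0, ← edist_dist]
        exact hd.trans_lt hL
      have ht := (hr (y.face, t) hq).2 i j y.pt hy hlt
      obtain ⟨s, hs'⟩ := mem_hypSegment_iff_bary.1 ht
      have hst := hbi y.face hs'
      subst hst
      refine ⟨(z.face, stdSimplex.map ![k, l] s), ?_, rfl, ?_⟩
      · change z.face.1 _ = x
        rw [← side_apply, ← hs, side_apply]
        exact hq
      · refine le_trans (le_of_eq ?_) hd
        rw [edist_dist, edist_dist, dist_eq_abs_of_mem_hypSegment hy ht,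
          dist_eq_abs_of_mem_hypSegment hz (w := b z.face (stdSimplex.map ![k, l] s))
            (onSide_facePt z.face k l s), hdist]
        congr 3
        exact (hℓ.dist_side hs s).symm
  refine ⟨ENNReal.ofReal r, ENNReal.ofReal_pos.2 hr0, fun y hy => ?_⟩
  obtain ⟨q₀, hq₀⟩ := h𝓕.cover x
  obtain ⟨⟨f, t⟩, rfl⟩ := h𝓕.cover y
  rw [← hq₀, h𝓕.toCone_apply hℓ, h𝓕.toCone_apply hℓ] at hy
  obtain ⟨L, hL, hch⟩ := exists_chain_of_edist_lt hy
  obtain ⟨q, hq, hqf, hd⟩ := key q₀ _ L hq₀ hch hL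
  have hqf : q.1 = f := hqf
  subst hqf
  refine (hr q hq).1 t ?_
  rw [← ENNReal.ofReal_lt_ofReal_iff hr0, ← edist_dist]
  exact hd.trans_lt hL

theorem IsFaceSystem.isHomeomorph_toCone [T1Space M] (h𝓕 : IsFaceSystem 𝓕)
    (hℓ : IsLengthFunction ℓ) (hnd : NonDegenerate ℓ) : IsHomeomorph (h𝓕.toCone ℓ) where
  continuous := h𝓕.continuous_toCone hℓ
  bijective := by
    refine ⟨fun x y hxy => ?_, h𝓕.surjective_toCone hℓ⟩
    by_contra hne
    obtain ⟨r, hr, h⟩ := h𝓕.exists_forall_edist_toCone_lt hℓ hnd x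
      (isOpen_compl_singleton.mem_nhds (show x ∈ ({y} : Set M)ᶜ from hne))
    exact h y (by rwa [hxy, edist_self]) rfl
  isOpenMap := by
    intro U hU
    refine isOpen_iff_mem_nhds.2 ?_
    rintro _ ⟨x, hx, rfl⟩
    obtain ⟨r, hr, h⟩ := h𝓕.exists_forall_edist_toCone_lt hℓ hnd x (hU.mem_nhds hx)
    refine EMetric.mem_nhds_iff.2 ⟨r, hr, fun c hc => ?_⟩
    obtain ⟨y, rfl⟩ := h𝓕.surjective_toCone hℓ c
    exact ⟨y, h y (by rw [edist_comm]; exact hc), rfl⟩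

end FaceSystem

/-! ### Triangulations and their lifts are systems of faces -/

section Triangulation

open Topology

theorem stdSimplex_map_pair_apply (i j m : Fin 3) (s : stdSimplex ℝ (Fin 2)) :
    stdSimplex.map ![i, j] s m = (if i = m then s 0 else 0) + if j = m then s 1 else 0 := by
  rw [stdSimplex.map_coe, FunOnFinite.linearMap_apply_apply, Finset.sum_filter, Fin.sum_univ_two]
  rfl

theorem stdSimplex_map_pair_swap (i j : Fin 3) (s : stdSimplex ℝ (Fin 2)) :
    stdSimplex.map ![j, i] (stdSimplex.map ![1, 0] s) = stdSimplex.map ![i, j] s := by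
  rw [stdSimplex.map_comp_apply]
  congr 1
  funext k
  fin_cases k <;> rfl

theorem stdSimplex_map_swap_pos {s : stdSimplex ℝ (Fin 2)} (hs : ∀ k, 0 < s k) (k : Fin 2) :
    0 < stdSimplex.map ![1, 0] s k := by
  rw [stdSimplex.map_coe, FunOnFinite.linearMap_apply_apply, Finset.sum_filter, Fin.sum_univ_two]
  fin_cases k <;> simp [hs]

theorem stdSimplex_map_pair_injective {i j : Fin 3} (hij : i ≠ j) :
    Function.Injective (stdSimplex.map (S := ℝ) ![i, j]) := by
  intro s s' h
  have hi := DFunLike.congr_fun h i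
  have hj := DFunLike.congr_fun h j
  simp only [stdSimplex_map_pair_apply, if_pos, if_neg hij, if_neg hij.symm, add_zero,
    zero_add] at hi hj
  refine stdSimplex.ext (funext fun k => ?_)
  fin_cases k
  exacts [hi, hj]

theorem stdSimplex_cases (t : stdSimplex ℝ (Fin 3)) : (∀ k, 0 < t k) ∨
    (∃ i, t = stdSimplex.vertex i) ∨
    ∃ i j s, i ≠ j ∧ (∀ k, 0 < s k) ∧ t = stdSimplex.map ![i, j] s := by
  by_cases h : ∀ k, 0 < t k
  · exact Or.inl h
  right
  push Not at h
  obtain ⟨k, hk⟩ := h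
  have hk0 : t k = 0 := le_antisymm hk (stdSimplex.zero_le t k)
  have hcov : ∀ k m : Fin 3, m = k ∨ m = k + 1 ∨ m = k + 2 := by decide
  have hne1 : ∀ k : Fin 3, k + 1 ≠ k + 2 := by decide
  have hne2 : ∀ k : Fin 3, k + 1 ≠ k := by decide
  have hne3 : ∀ k : Fin 3, k + 2 ≠ k := by decide
  have hsum : t (k + 1) + t (k + 2) = 1 := by
    have h1 := stdSimplex.sum_eq_one t
    rw [← Equiv.sum_comp (Equiv.addLeft k), Fin.sum_univ_three] at h1
    simp only [Equiv.coe_addLeft, add_zero, hk0, zero_add] at h1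
    exact h1
  rcases (stdSimplex.zero_le t (k + 1)).eq_or_lt with h1 | h1
  · refine Or.inl ⟨k + 2, stdSimplex.ext (funext fun m => ?_)⟩
    rw [stdSimplex.vertex_coe]
    rcases hcov k m with rfl | rfl | rfl
    · rw [Pi.single_eq_of_ne (hne3 _).symm, hk0]
    · rw [Pi.single_eq_of_ne (hne1 _), h1]
    · rw [Pi.single_eq_same]
      linarith
  rcases (stdSimplex.zero_le t (k + 2)).eq_or_lt with h2 | h2
  · refine Or.inl ⟨k + 1, stdSimplex.ext (funext fun m => ?_)⟩
    rw [stdSimplex.vertex_coe]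
    rcases hcov k m with rfl | rfl | rfl
    · rw [Pi.single_eq_of_ne (hne2 _).symm, hk0]
    · rw [Pi.single_eq_same]
      linarith
    · rw [Pi.single_eq_of_ne (hne1 _).symm, h2]
  · refine Or.inr ⟨k + 1, k + 2, ⟨![t (k + 1), t (k + 2)], fun m => ?_, ?_⟩, hne1 k, fun m => ?_,
      stdSimplex.ext (funext fun m => ?_)⟩
    · fin_cases m
      exacts [h1.le, h2.le]
    · rw [Fin.sum_univ_two]
      exact hsum
    · fin_cases m
      exacts [h1, h2]
    · rw [stdSimplex_map_pair_apply]
      rcases hcov k m with rfl | rfl | rfl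
      · rw [if_neg (hne2 _), if_neg (hne3 _), hk0, add_zero]
      · rw [if_pos rfl, if_neg (hne1 _).symm, add_zero]
        rfl
      · rw [if_neg (hne1 _), if_pos rfl, zero_add]
        rfl

variable {S : Type u} [TopologicalSpace S]

/-- Sides belong to `E` only up to reversal; `i` and `j` are ordered so that the side itself is an
edge and `edge_inj` applies. -/
theorem Triangulation.cases (T : Triangulation S) (f : T.F) (t : stdSimplex ℝ (Fin 3)) :
    (∀ k, 0 < t k) ∨ (∃ i, t = stdSimplex.vertex i) ∨
    ∃ i j s, i ≠ j ∧ (∀ k, 0 < s k) ∧ side f.1 i j ∈ T.E ∧ t = stdSimplex.map ![i, j] s := by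
  rcases stdSimplex_cases t with h | h | ⟨i, j, s, hij, hs, rfl⟩
  · exact Or.inl h
  · exact Or.inr (Or.inl h)
  · refine Or.inr (Or.inr ?_)
    rcases T.side_mem f.1 f.2 i j hij with h | h
    · exact ⟨i, j, s, hij, hs, h, rfl⟩
    · exact ⟨j, i, _, hij.symm, stdSimplex_map_swap_pos hs, h, (stdSimplex_map_pair_swap i j s).symm⟩

/-- Open cells of different dimensions are disjoint, so both points are interior, both are vertices,
or both lie inside edges. Injectivity on open cells settles the first and last cases. -/
theorem Triangulation.overlap (T : Triangulation S) (f f' : T.F) (t t' : stdSimplex ℝ (Fin 3))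
    (h : f.1 t = f'.1 t') : (f = f' ∧ t = t') ∨
    (∃ i k, t = stdSimplex.vertex i ∧ t' = stdSimplex.vertex k) ∨
    ∃ i j k l s, i ≠ j ∧ side f.1 i j = side f'.1 k l ∧ t = stdSimplex.map ![i, j] s ∧
      t' = stdSimplex.map ![k, l] s := by
  rcases T.cases f t with h1 | ⟨i, rfl⟩ | ⟨i, j, s, hij, hs, he, rfl⟩ <;>
    rcases T.cases f' t' with h2 | ⟨k, rfl⟩ | ⟨k, l, s', hkl, hs', he', rfl⟩
  · have := T.face_inj f.1 f.2 f'.1 f'.2 t t' h1 h2 h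
    exact Or.inl ⟨Subtype.ext this.1, this.2⟩
  · exact absurd (h ▸ T.vertex_mem f'.2 k) (T.vertex_ne_face f.1 f.2 t h1)
  · exact absurd h.symm (T.edge_ne_face _ he' f.1 f.2 s' t hs' h1)
  · exact absurd (h.symm ▸ T.vertex_mem f.2 i) (T.vertex_ne_face f'.1 f'.2 t' h2)
  · exact Or.inr (Or.inl ⟨i, k, rfl, rfl⟩)
  · refine absurd ?_ (T.vertex_ne_edge _ he' s' hs')
    rw [side_apply, ← h]
    exact T.vertex_mem f.2 i
  · exact absurd h (T.edge_ne_face _ he f'.1 f'.2 s t' hs h2)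
  · refine absurd ?_ (T.vertex_ne_edge _ he s hs)
    rw [side_apply, h]
    exact T.vertex_mem f'.2 k
  · obtain ⟨h3, rfl⟩ := T.edge_inj _ he _ he' s s' hs hs' h
    exact Or.inr (Or.inr ⟨i, j, k, l, s, hij, h3, rfl, rfl⟩)

/-- Within one face, fix a preimage `t₀`. By `overlap` any other is a vertex or is determined by
`t₀` and four indices, since sides are parametrized injectively. -/
theorem Triangulation.finite_fiber (T : Triangulation S) (x : S) :
    {q : T.F × stdSimplex ℝ (Fin 3) | q.1.1 q.2 = x}.Finite := by
  have hF : Finite T.F := T.finite_F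
  have h1 : ∀ f : T.F, {t | f.1 t = x}.Finite := by
    intro f
    rcases Set.eq_empty_or_nonempty {t | f.1 t = x} with h | ⟨t₀, ht₀⟩
    · rw [h]
      exact Set.finite_empty
    refine (((Set.finite_singleton t₀).union
      (Set.finite_range (stdSimplex.vertex (S := ℝ) (X := Fin 3)))).union
      (Set.finite_iUnion fun i : Fin 3 => Set.finite_iUnion fun j : Fin 3 =>
      Set.finite_iUnion fun k : Fin 3 => Set.finite_iUnion fun l : Fin 3 =>
      (Set.Subsingleton.finite (s := {t | ∃ s, i ≠ j ∧ t₀ = stdSimplex.map ![i, j] s ∧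
        t = stdSimplex.map ![k, l] s}) ?_))).subset ?_
    · rintro _ ⟨s, hij, hs, rfl⟩ _ ⟨s', -, hs', rfl⟩
      rw [stdSimplex_map_pair_injective hij (hs.symm.trans hs')]
    · intro t ht
      have hft : f.1 t₀ = f.1 t := by
        rw [show f.1 t₀ = x from ht₀, show f.1 t = x from ht]
      rcases T.overlap f f t₀ t hft with ⟨-, rfl⟩ | ⟨i, k, -, rfl⟩ | ⟨i, j, k, l, s, hij, -, h1, h2⟩
      · exact Or.inl (Or.inl rfl)
      · exact Or.inl (Or.inr ⟨k, rfl⟩)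
      · simp only [Set.mem_union, Set.mem_iUnion]
        exact Or.inr ⟨i, j, k, l, s, hij, h1, h2⟩
  refine (Set.finite_iUnion fun f : T.F => (h1 f).image (Prod.mk f)).subset ?_
  rintro ⟨f, t⟩ h
  exact Set.mem_iUnion.2 ⟨f, t, h, rfl⟩

/-- Outside the neighborhoods each face is compact, so its image is closed and misses `x`. The
complement of these finitely many images is the required neighborhood. -/
theorem Triangulation.star_mem [T2Space S] (T : Triangulation S) (x : S)
    (W : T.F × stdSimplex ℝ (Fin 3) → Set (stdSimplex ℝ (Fin 3)))
    (hW : ∀ q, q.1.1 q.2 = x → W q ∈ 𝓝 q.2) :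
    {y | ∃ q : T.F × stdSimplex ℝ (Fin 3), q.1.1 q.2 = x ∧ ∃ w ∈ W q, q.1.1 w = y} ∈ 𝓝 x := by
  have hF : Finite T.F := T.finite_F
  let K : T.F → Set (stdSimplex ℝ (Fin 3)) := fun f => (⋃ t ∈ {t | f.1 t = x}, interior (W (f, t)))ᶜ
  have hK : ∀ f, IsClosed (f.1 '' K f) := fun f =>
    ((isOpen_biUnion fun _ _ => isOpen_interior).isClosed_compl.isCompact.image
      f.1.continuous).isClosed
  have hxK : ∀ f, x ∉ f.1 '' K f := by
    rintro f ⟨t, ht, rfl⟩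
    exact ht (Set.mem_biUnion (show t ∈ {t' | f.1 t' = f.1 t} from rfl)
      (mem_interior_iff_mem_nhds.2 (hW (f, t) rfl)))
  filter_upwards [Filter.iInter_mem.2 fun f => (hK f).isOpen_compl.mem_nhds (hxK f)] with y hy
  obtain ⟨f, hf, w, rfl⟩ := T.cover y
  have h1 : w ∉ K ⟨f, hf⟩ := fun h => Set.mem_iInter.1 hy ⟨f, hf⟩ ⟨w, h, rfl⟩
  obtain ⟨t, ht, hw⟩ := Set.mem_iUnion₂.1 (not_not.1 h1)
  exact ⟨(⟨f, hf⟩, t), ht, w, interior_subset hw, rfl⟩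

theorem Triangulation.isFaceSystem [T2Space S] (T : Triangulation S) : IsFaceSystem T.F where
  cover x := by
    obtain ⟨f, hf, t, ht⟩ := T.cover x
    exact ⟨(⟨f, hf⟩, t), ht⟩
  overlap := T.overlap
  finite_fiber := T.finite_fiber
  star_mem := T.star_mem

end Triangulation

/-! ### Lifting faces and adjacencies through the covering -/

section Lift

open Topology

variable {S : Type u} {S' : Type v} [TopologicalSpace S] [TopologicalSpace S'] {p : C(S', S)}

theorem IsCoveringMap.continuousMap_eq_of_comp_eq (hp : IsCoveringMap p) {A : Type*}
    [TopologicalSpace A] [PreconnectedSpace A] {g g' : C(A, S')} (h : p.comp g = p.comp g') (a : A)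
    (ha : g a = g' a) : g = g' :=
  DFunLike.coe_injective (hp.eq_of_comp_eq g.continuous g'.continuous
    (congrArg DFunLike.coe h) a ha)

instance (n : ℕ) : ContractibleSpace (stdSimplex ℝ (Fin (n + 1))) :=
  (convex_stdSimplex ℝ (Fin (n + 1))).contractibleSpace ⟨_, (stdSimplex.vertex 0).2⟩

instance (n : ℕ) : LocallyPathConnectedSpace (stdSimplex ℝ (Fin (n + 1))) :=
  (convex_stdSimplex ℝ (Fin (n + 1))).locallyPathConnectedSpace

theorem IsCoveringMap.exists_simplex_lift (hp : IsCoveringMap p) {n : ℕ}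
    (f : C(stdSimplex ℝ (Fin (n + 1)), S)) (t : stdSimplex ℝ (Fin (n + 1))) {s : S'}
    (hs : p s = f t) : ∃ g : C(stdSimplex ℝ (Fin (n + 1)), S'), p.comp g = f ∧ g t = s := by
  obtain ⟨g, ⟨h1, h2⟩, -⟩ := hp.existsUnique_continuousMap_lifts f t s hs
  exact ⟨g, DFunLike.coe_injective h2, h1⟩

theorem IsCoveringMap.surjective_of_pathConnected (hp : IsCoveringMap p) [Nonempty S']
    [PathConnectedSpace S] : Function.Surjective p := by
  intro x
  obtain ⟨e⟩ := ‹Nonempty S'›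
  obtain ⟨c⟩ := PathConnectedSpace.joined (p e) x
  obtain ⟨g, hg, -⟩ := hp.exists_path_lifts c.toContinuousMap e c.source
  exact ⟨g 1, (congrFun hg 1).trans c.target⟩

theorem IsCoveringMap.t2Space (hp : IsCoveringMap p) [T2Space S] : T2Space S' := by
  refine ⟨fun x y hxy => ?_⟩
  by_cases h : p x = p y
  · exact hp.isSeparatedMap x y h hxy
  · obtain ⟨U, V, hU, hV, hx, hy, hd⟩ := t2_separation h
    exact ⟨p ⁻¹' U, p ⁻¹' V, hU.preimage p.continuous, hV.preimage p.continuous, hx, hy,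
      hd.preimage p⟩

theorem IsLocalHomeomorph.locallyPathConnectedSpace (hp : IsLocalHomeomorph p)
    [LocallyPathConnectedSpace S] : LocallyPathConnectedSpace S' := by
  choose e he _ using hp
  -- Local restrictions of `p` serve as charts modelled on `S`.
  let _ : ChartedSpace S S' :=
    { atlas := Set.range e
      chartAt := e
      mem_chart_source := he
      chart_mem_atlas := fun x => ⟨x, rfl⟩ }
  exact ChartedSpace.locallyPathConnectedSpace S S'

theorem IsCoveringMap.exists_injOn_nhds (hp : IsCoveringMap p) (s : S') :
    ∃ U : Set S', IsOpen U ∧ s ∈ U ∧ Set.InjOn p U := by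
  obtain ⟨e, he, h⟩ := hp.isLocalHomeomorph s
  exact ⟨e.source, e.open_source, he, by rw [h]; exact e.injOn⟩

theorem deckGroup_eq_one (hp : IsCoveringMap p) [PreconnectedSpace S'] {γ : deckGroup p} {s : S'}
    (h : γ.1 s = s) : γ = 1 := by
  refine Subtype.ext (Homeomorph.ext fun x => ?_)
  exact congrFun (hp.eq_of_comp_eq γ.1.continuous continuous_id (funext fun x => γ.2 x) s h) x

/-- Lift `p` through itself, from `s` to `s'` and back; by uniqueness of lifts the two maps are
inverse to each other. -/
theorem exists_deckGroup_apply_eq (hp : IsCoveringMap p) [SimplyConnectedSpace S']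
    [LocallyPathConnectedSpace S'] {s s' : S'} (h : p s = p s') :
    ∃ γ : deckGroup p, γ.1 s = s' := by
  obtain ⟨g, ⟨h1, h2⟩, -⟩ := hp.existsUnique_continuousMap_lifts p s s' h.symm
  obtain ⟨g', ⟨h1', h2'⟩, -⟩ := hp.existsUnique_continuousMap_lifts p s' s h
  have e1 : ∀ x, g' (g x) = x := congrFun (hp.eq_of_comp_eq (g'.continuous.comp g.continuous)
    continuous_id (funext fun x => (congrFun h2' (g x)).trans (congrFun h2 x)) s (by simp [h1, h1']))
  have e2 : ∀ x, g (g' x) = x := congrFun (hp.eq_of_comp_eq (g.continuous.comp g'.continuous)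
    continuous_id (funext fun x => (congrFun h2 (g' x)).trans (congrFun h2' x)) s'
      (by simp [h1, h1']))
  exact ⟨⟨⟨⟨g, g', e1, e2⟩, g.continuous, g'.continuous⟩, fun x => congrFun h2 x⟩, h1⟩

variable {T : Triangulation S}

/-- The face of the triangulation covered by a face of the lifted triangulation. -/
def projFace (g : liftF T p) : T.F := ⟨p.comp g.1, g.2⟩

theorem liftFace_eq (hp : IsCoveringMap p) {g g' : liftF T p} (h : projFace g = projFace g')
    (t : stdSimplex ℝ (Fin 3)) (ht : g.1 t = g'.1 t) : g = g' :=
  Subtype.ext (hp.continuousMap_eq_of_comp_eq (congrArg Subtype.val h) t ht)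

theorem exists_liftFace (hp : IsCoveringMap p) (f : T.F) (t : stdSimplex ℝ (Fin 3)) {s : S'}
    (hs : p s = f.1 t) : ∃ g : liftF T p, projFace g = f ∧ g.1 t = s := by
  obtain ⟨g, h1, h2⟩ := hp.exists_simplex_lift f.1 t hs
  exact ⟨⟨g, show p.comp g ∈ T.F by rw [h1]; exact f.2⟩, Subtype.ext h1, h2⟩

theorem side_eq_of_side_projFace_eq (hp : IsCoveringMap p) {g g' : liftF T p} {i j k l : Fin 3}
    (h : side (projFace g).1 i j = side (projFace g').1 k l) (s : stdSimplex ℝ (Fin 2))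
    (hs : side g.1 i j s = side g'.1 k l s) : side g.1 i j = side g'.1 k l :=
  hp.continuousMap_eq_of_comp_eq h s hs

/-- Faces lift to adjacent faces. -/
theorem exists_liftFace_side_eq (hp : IsCoveringMap p) (g : liftF T p) (f' : T.F) {i j k l : Fin 3}
    (h : side (projFace g).1 i j = side f'.1 k l) :
    ∃ g' : liftF T p, projFace g' = f' ∧ side g.1 i j = side g'.1 k l := by
  have h1 := DFunLike.congr_fun h (stdSimplex.vertex 0)
  obtain ⟨g', rfl, h2⟩ := exists_liftFace hp f'
    (stdSimplex.map ![k, l] (stdSimplex.vertex 0)) (s := side g.1 i j (stdSimplex.vertex 0)) h1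
  exact ⟨g', rfl, side_eq_of_side_projFace_eq hp h _ h2.symm⟩

theorem exists_deckFace_eq (hp : IsCoveringMap p) [SimplyConnectedSpace S']
    [LocallyPathConnectedSpace S'] {g g' : liftF T p} (h : projFace g = projFace g') :
    ∃ γ : deckGroup p, deckFace γ g = g' := by
  have h1 := DFunLike.congr_fun (congrArg Subtype.val h) (stdSimplex.vertex 0)
  obtain ⟨γ, hγ⟩ := exists_deckGroup_apply_eq hp h1
  refine ⟨γ, liftFace_eq hp ?_ (stdSimplex.vertex 0) hγ⟩
  rw [← h]
  exact Subtype.ext (ContinuousMap.ext fun t => γ.2 (g.1 t))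

/-- Lifts of the same face that agree at a point coincide, so overlaps and finiteness of fibres are
inherited from `T`. For stars, a sheet around `x` on which `p` is injective lets equalities in `S`
be read in `S'`. -/
theorem isFaceSystem_liftF [T2Space S] (hp : IsCoveringMap p) (T : Triangulation S) :
    IsFaceSystem (liftF T p) where
  cover x := by
    obtain ⟨f, hf, t, ht⟩ := T.cover (p x)
    obtain ⟨g, -, hg⟩ := exists_liftFace hp ⟨f, hf⟩ t ht.symm
    exact ⟨(g, t), hg⟩
  overlap g g' t t' h := by
    rcases T.overlap (projFace g) (projFace g') t t' (congrArg p h) with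
      ⟨h1, rfl⟩ | h1 | ⟨i, j, k, l, s, hij, h1, rfl, rfl⟩
    · exact Or.inl ⟨liftFace_eq hp h1 t h, rfl⟩
    · exact Or.inr (Or.inl h1)
    · exact Or.inr (Or.inr ⟨i, j, k, l, s, hij, side_eq_of_side_projFace_eq hp h1 s h, rfl, rfl⟩)
  finite_fiber x := by
    refine Set.Finite.of_finite_image (f := fun q => (projFace q.1, q.2))
      ((T.finite_fiber (p x)).subset ?_) ?_
    · rintro _ ⟨⟨g, t⟩, hq, rfl⟩
      exact congrArg p hq
    · rintro ⟨g, t⟩ hq ⟨g', t'⟩ hq' h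
      obtain ⟨h1, rfl⟩ := Prod.mk.inj h
      exact Prod.ext (liftFace_eq hp h1 t (Eq.trans hq (Eq.symm hq'))) rfl
  star_mem x W hW := by
    obtain ⟨U, hU, hxU, hinj⟩ := hp.exists_injOn_nhds x
    -- The quantifier over `g` ranges over at most one lift, so these sets are still neighborhoods.
    have h1 := T.star_mem (p x) (fun q => {w | ∀ g : liftF T p, projFace g = q.1 → g.1 q.2 = x →
      w ∈ W (g, q.2) ∧ g.1 w ∈ U}) (by
        rintro ⟨f, t⟩ hq
        obtain ⟨g, rfl, hg⟩ := exists_liftFace hp f t (Eq.symm hq)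
        filter_upwards [hW (g, t) hg,
          g.1.continuous.continuousAt.preimage_mem_nhds (hU.mem_nhds (by rwa [hg]))] with w h1 h2
        intro g' hg' hgt
        rw [liftFace_eq hp hg' t (hgt.trans hg.symm)]
        exact ⟨h1, h2⟩)
    filter_upwards [hU.mem_nhds hxU, p.continuous.continuousAt.preimage_mem_nhds h1] with y hyU hy
    obtain ⟨⟨f, t⟩, hq, w, hw, hwy⟩ := hy
    obtain ⟨g, rfl, hg⟩ := exists_liftFace hp f t (Eq.symm hq)
    have h2 := hw g rfl hg
    exact ⟨(g, t), hg, w, h2.1, hinj h2.2 hyU hwy⟩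

variable {X : Type w} [MetricSpace X]

theorem liftVertex_eq_of_side_eq {g g' : liftF T p} {i j k l : Fin 3}
    (h : side g.1 i j = side g'.1 k l) :
    liftVertex g i = liftVertex g' k ∧ liftVertex g j = liftVertex g' l := by
  have h0 := DFunLike.congr_fun h (stdSimplex.vertex 0)
  have h1 := DFunLike.congr_fun h (stdSimplex.vertex 1)
  rw [side_apply, side_apply, stdSimplex.map_vertex, stdSimplex.map_vertex] at h0 h1
  exact ⟨Subtype.ext h0, Subtype.ext h1⟩

theorem isLengthFunction_upLength (F : liftV T p → X) : IsLengthFunction (upLength F) where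
  realized g i j := dist_triangleOfLengths (fun i => F (liftVertex g i)) i j
  side_congr g g' i j k l h := by
    obtain ⟨h1, h2⟩ := liftVertex_eq_of_side_eq h
    rw [upLength, upLength, h1, h2]

/-- The lift chosen in `downLength` is immaterial: any two differ by a deck transformation, which
preserves `upLength`. -/
theorem downLength_projFace (hp : IsCoveringMap p) [SimplyConnectedSpace S']
    [LocallyPathConnectedSpace S'] {ρ : deckGroup p →* (X ≃ᵢ X)} {F : liftV T p → X}
    (hF : IsEquivariant ρ F) (g : liftF T p) : downLength F (projFace g) = upLength F g := by
  have h : ∃ g' : liftF T p, p.comp g'.1 = (projFace g).1 := ⟨g, rfl⟩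
  obtain ⟨γ, hγ⟩ := exists_deckFace_eq hp (g := g) (g' := h.choose)
    (Subtype.ext h.choose_spec.symm)
  funext i j
  rw [downLength, dif_pos h, ← hγ, upLength_deckFace hF]

theorem exists_projFace_eq (hp : IsCoveringMap p) (hsurj : Function.Surjective p) (f : T.F) :
    ∃ g : liftF T p, projFace g = f := by
  obtain ⟨s, hs⟩ := hsurj (f.1 (stdSimplex.vertex 0))
  obtain ⟨g, hg, -⟩ := exists_liftFace hp f _ hs
  exact ⟨g, hg⟩

theorem isLengthFunction_downLength (hp : IsCoveringMap p) (hsurj : Function.Surjective p)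
    [SimplyConnectedSpace S'] [LocallyPathConnectedSpace S'] {ρ : deckGroup p →* (X ≃ᵢ X)}
    {F : liftV T p → X} (hF : IsEquivariant ρ F) : IsLengthFunction (downLength F) where
  realized f i j := by
    obtain ⟨g, rfl⟩ := exists_projFace_eq hp hsurj f
    rw [downLength_projFace hp hF]
    exact (isLengthFunction_upLength F).realized g i j
  side_congr f f' i j k l h := by
    obtain ⟨g, rfl⟩ := exists_projFace_eq hp hsurj f
    obtain ⟨g', rfl, hg'⟩ := exists_liftFace_side_eq hp g f' h
    rw [downLength_projFace hp hF, downLength_projFace hp hF]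
    exact (isLengthFunction_upLength F).side_congr g g' i j k l hg'

theorem nonDegenerate_downLength (hp : IsCoveringMap p) (hsurj : Function.Surjective p)
    [SimplyConnectedSpace S'] [LocallyPathConnectedSpace S'] {ρ : deckGroup p →* (X ≃ᵢ X)}
    {F : liftV T p → X} (hF : IsEquivariant ρ F) (hnd : NonDegenerate (upLength F)) :
    NonDegenerate (downLength F) := by
  intro f
  obtain ⟨g, rfl⟩ := exists_projFace_eq hp hsurj f
  rw [downLength_projFace hp hF]
  exact hnd g

end Lift

/-! ### Domination -/

section Domination

open Topology

variable {S : Type u} {S' : Type v} [TopologicalSpace S] [TopologicalSpace S'] {p : C(S', S)}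
  {T : Triangulation S} {X : Type w} [MetricSpace X]

theorem deckFace_injective (hp : IsCoveringMap p) [PreconnectedSpace S'] (g : liftF T p) :
    Function.Injective fun γ : deckGroup p => deckFace γ g := by
  intro γ δ h
  have h1 : γ.1 (g.1 (stdSimplex.vertex 0)) = δ.1 (g.1 (stdSimplex.vertex 0)) :=
    DFunLike.congr_fun (congrArg Subtype.val h) (stdSimplex.vertex 0)
  have h2 : (δ⁻¹ * γ).1 (g.1 (stdSimplex.vertex 0)) = g.1 (stdSimplex.vertex 0) := by
    change δ.1.symm (γ.1 _) = _
    rw [h1, Homeomorph.symm_apply_apply]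
  exact (inv_mul_eq_one.1 (deckGroup_eq_one hp h2)).symm

theorem IsGeodesicFromTo.map_isometryEquiv {c : ℝ → X} {x y : X} (h : IsGeodesicFromTo c x y)
    (e : X ≃ᵢ X) : IsGeodesicFromTo (fun t => e (c t)) (e x) (e y) where
  source := by rw [h.source]
  target := by rw [e.dist_eq, h.target]
  isometric s hs t ht := by
    rw [e.dist_eq] at hs ht ⊢
    exact h.isometric s hs t ht

/-- Equivariant `1`-Lipschitz extensions of the comparison maps of the lifted faces. -/
theorem exists_equivariant_comparison_maps (hp : IsCoveringMap p) [SimplyConnectedSpace S']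
    [LocallyPathConnectedSpace S'] (hsurj : Function.Surjective p) [CompleteSpace X]
    (hX : IsCATNegOne X) {ρ : deckGroup p →* (X ≃ᵢ X)} {F : liftV T p → X}
    (hF : IsEquivariant ρ F) :
    ∃ h : liftF T p → ℍ → X, (∀ g, LipschitzWith 1 (h g)) ∧
      (∀ (g : liftF T p) i j c, IsGeodesicFromTo c (F (liftVertex g i)) (F (liftVertex g j)) →
        ∀ z ∈ hypSegment (triangleOfLengths (upLength F g) i) (triangleOfLengths (upLength F g) j),
          h g z = c (dist (triangleOfLengths (upLength F g) i) z)) ∧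
      ∀ γ g z, h (deckFace γ g) z = ρ γ (h g z) := by
  -- `b` picks one lift of every face, and `d g` is the deck transformation carrying it to `g`.
  -- Freeness makes `d g` unique, hence `d (γ g) = γ * d g`, which gives equivariance.
  choose b hb using exists_projFace_eq (T := T) hp hsurj
  have h0 : ∀ g : liftF T p, ∃ γ : deckGroup p, deckFace γ (b (projFace g)) = g := fun g =>
    exists_deckFace_eq hp (hb (projFace g))
  choose d hd using h0
  choose h hh1 hh2 using fun f : T.F => hX.exists_comparison_map
    (x := fun i => F (liftVertex (b f) i)) (a := triangleOfLengths (upLength F (b f)))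
    fun i j => (isLengthFunction_upLength F).realized (b f) i j
  refine ⟨fun g z => ρ (d g) (h (projFace g) z), fun g => ?_, fun g i j c hc z hz => ?_,
    fun γ g z => ?_⟩
  · have := (ρ (d g)).isometry.lipschitz.comp (hh1 (projFace g))
    rwa [one_mul] at this
  · have hv : ∀ i, F (liftVertex g i) = ρ (d g) (F (liftVertex (b (projFace g)) i)) := fun i =>
      hF (d g) (liftVertex (b (projFace g)) i) (liftVertex g i) (by
        conv_lhs => rw [← hd g]
        rfl)
    have hl : upLength F g = upLength F (b (projFace g)) := by
      conv_lhs => rw [← hd g]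
      exact upLength_deckFace hF _ _
    have hc' := hc.map_isometryEquiv (ρ (d g)).symm
    rw [hv, hv, IsometryEquiv.symm_apply_apply, IsometryEquiv.symm_apply_apply] at hc'
    rw [hl] at hz ⊢
    change ρ (d g) (h (projFace g) z) = _
    rw [hh2 (projFace g) i j _ hc' z hz, IsometryEquiv.apply_symm_apply]
  · have e1 : projFace (deckFace γ g) = projFace g :=
      Subtype.ext (ContinuousMap.ext fun t => γ.2 (g.1 t))
    have e2 : d (deckFace γ g) = γ * d g := by
      apply deckFace_injective hp (b (projFace g))
      have := hd (deckFace γ g)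
      rw [e1] at this
      change deckFace (d (deckFace γ g)) (b (projFace g)) = deckFace γ (deckFace (d g) _)
      rw [this, hd]
    change ρ (d (deckFace γ g)) (h (projFace (deckFace γ g)) z) = _
    rw [e1, e2, map_mul]
    rfl

/-- `ρ_F` dominates `ρ`. -/
theorem exists_isDomination (hp : IsCoveringMap p) [SimplyConnectedSpace S']
    [LocallyPathConnectedSpace S'] (hsurj : Function.Surjective p) [CompleteSpace X]
    (hX : IsCATNegOne X) {ρ : deckGroup p →* (X ≃ᵢ X)} {F : liftV T p → X}
    (hF : IsEquivariant ρ F) :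
    ∃ f : ConeFLift F → X, IsDomination (coneRep hF) ρ f ∧
      ∀ (x : FacePoint (liftF T p) (upLength F)) (i j : Fin 3), x.OnSide i j →
        dist (F (liftVertex x.face i)) (f (Cone.mk x)) =
            dist (triangleOfLengths (upLength F x.face) i) x.pt ∧
          dist (f (Cone.mk x)) (F (liftVertex x.face j)) =
            dist x.pt (triangleOfLengths (upLength F x.face) j) := by
  obtain ⟨h, h1, h2, h3⟩ := exists_equivariant_comparison_maps hp hsurj hX hF
  -- On a common side both maps follow one geodesic of `X`, fixed by the images of the common
  -- endpoints, at the same arc length.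
  have hglue : ∀ x y : FacePoint (liftF T p) (upLength F), Glued x y →
      h x.face x.pt = h y.face y.pt := by
    rintro x y ⟨i, j, k, l, hs, hx, hy, hd⟩
    obtain ⟨e1, e2⟩ := liftVertex_eq_of_side_eq hs
    obtain ⟨c, hc⟩ := hX.geodesic (F (liftVertex x.face i)) (F (liftVertex x.face j))
    rw [h2 x.face i j c hc _ hx, hd]
    rw [e1, e2] at hc
    exact (h2 y.face k l c hc _ hy).symm
  have hle : ∀ x y : FacePoint (liftF T p) (upLength F),
      edist (h x.face x.pt) (h y.face y.pt) ≤ edist x y := by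
    intro x y
    change _ ≤ sInf {L | Chain x y L}
    refine le_sInf fun L (hL : Chain x y L) => ?_
    induction hL with
    | refl => simp
    | @move y z L _ hf ih =>
      refine (edist_triangle _ (h y.face y.pt) _).trans (add_le_add ih ?_)
      rw [← hf]
      simpa using h1 y.face y.pt z.pt
    | glue _ hg ih => rwa [← hglue _ _ hg]
  let f : ConeFLift F → X := SeparationQuotient.lift (fun x => h x.face x.pt) fun x y hxy =>
    edist_le_zero.1 ((hle x y).trans_eq (EMetric.inseparable_iff.1 hxy))
  refine ⟨f, ⟨?_, ?_⟩, fun x i j hx => ?_⟩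
  · intro c d
    obtain ⟨x, rfl⟩ := SeparationQuotient.surjective_mk c
    obtain ⟨y, rfl⟩ := SeparationQuotient.surjective_mk d
    rw [ENNReal.coe_one, one_mul]
    exact hle x y
  · intro γ c
    obtain ⟨x, rfl⟩ := SeparationQuotient.surjective_mk c
    exact h3 γ x.face x.pt
  · obtain ⟨c, hc⟩ := hX.geodesic (F (liftVertex x.face i)) (F (liftVertex x.face j))
    have e : f (Cone.mk x) = c (dist (triangleOfLengths (upLength F x.face) i) x.pt) :=
      h2 x.face i j c hc _ hx
    have hx' : dist (triangleOfLengths (upLength F x.face) i) x.pt +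
      dist x.pt (triangleOfLengths (upLength F x.face) j) =
        dist (F (liftVertex x.face i)) (F (liftVertex x.face j)) :=
      Eq.trans hx ((isLengthFunction_upLength F).realized x.face i j)
    have hmem : dist (triangleOfLengths (upLength F x.face) i) x.pt ∈
        Set.Icc 0 (dist (F (liftVertex x.face i)) (F (liftVertex x.face j))) :=
      ⟨dist_nonneg, by
        linarith [dist_nonneg (x := x.pt) (y := triangleOfLengths (upLength F x.face) j)]⟩
    rw [e]
    exact ⟨hc.dist_left hmem, by rw [hc.dist_right hmem]; linarith⟩

end Domination

/-! ### The projection of the lifted structure -/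

section Projection

open Topology

variable {S : Type u} {S' : Type v} [TopologicalSpace S] [TopologicalSpace S'] {p : C(S', S)}
  {T : Triangulation S} {X : Type w} [MetricSpace X] {ρ : deckGroup p →* (X ≃ᵢ X)}
  {F : liftV T p → X}

theorem FacePoint.ext_of {M : Type*} [TopologicalSpace M] {𝓕 : Set C(stdSimplex ℝ (Fin 3), M)}
    {ℓ : 𝓕 → Fin 3 → Fin 3 → ℝ} {x y : FacePoint 𝓕 ℓ} (h1 : x.face = y.face)
    (h2 : x.pt = y.pt) : x = y := by
  cases x
  cases y
  simp only at h1 h2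
  subst h1 h2
  rfl

/-- The set of points at finite distance from a given one is clopen, and the target is connected as
a continuous image. -/
theorem edist_ne_top_of_preconnected {M Y : Type*} [TopologicalSpace M] [PreconnectedSpace M]
    [EMetricSpace Y] {P : M → Y} (hP : Continuous P) (hsurj : Function.Surjective P) (y z : Y) :
    edist y z ≠ ⊤ := by
  have : PreconnectedSpace Y := ⟨by
    rw [← hsurj.range_eq]
    exact isPreconnected_range hP⟩
  have h1 : IsClopen {w | edist w y < ⊤} :=
    ⟨Metric.isClosed_eball_top, Metric.isOpen_eball⟩
  have h2 := h1.eq_univ ⟨y, by simp⟩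
  have h3 : z ∈ {w | edist w y < ⊤} := h2 ▸ Set.mem_univ z
  rw [edist_comm]
  exact ne_of_lt h3

variable [SimplyConnectedSpace S'] [LocallyPathConnectedSpace S']

/-- The point of `Δ_{p ∘ g}` corresponding to a point of `Δ_g`. -/
def projPoint (hp : IsCoveringMap p) (hF : IsEquivariant ρ F)
    (x : FacePoint (liftF T p) (upLength F)) : FacePoint T.F (downLength F) :=
  ⟨projFace x.face, x.pt, by rw [downLength_projFace hp hF]; exact x.mem⟩

theorem onSide_projPoint (hp : IsCoveringMap p) (hF : IsEquivariant ρ F)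
    {x : FacePoint (liftF T p) (upLength F)} {i j : Fin 3} :
    (projPoint hp hF x).OnSide i j ↔ x.OnSide i j := by
  change x.pt ∈ hypSegment (triangleOfLengths (downLength F (projFace x.face)) i)
    (triangleOfLengths (downLength F (projFace x.face)) j) ↔ _
  rw [downLength_projFace hp hF]
  rfl

theorem dist_projPoint (hp : IsCoveringMap p) (hF : IsEquivariant ρ F)
    (x : FacePoint (liftF T p) (upLength F)) (i : Fin 3) :
    dist (triangleOfLengths (downLength F (projPoint hp hF x).face) i) (projPoint hp hF x).pt =
      dist (triangleOfLengths (upLength F x.face) i) x.pt := by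
  change dist (triangleOfLengths (downLength F (projFace x.face)) i) x.pt = _
  rw [downLength_projFace hp hF]

theorem glued_projPoint (hp : IsCoveringMap p) (hF : IsEquivariant ρ F)
    {x y : FacePoint (liftF T p) (upLength F)} (h : Glued x y) :
    Glued (projPoint hp hF x) (projPoint hp hF y) := by
  obtain ⟨i, j, k, l, h1, h2, h3, h4⟩ := h
  refine ⟨i, j, k, l, ?_, (onSide_projPoint hp hF).2 h2, (onSide_projPoint hp hF).2 h3, ?_⟩
  · change p.comp (side x.face.1 i j) = p.comp (side y.face.1 k l)
    rw [h1]
  · rw [dist_projPoint, dist_projPoint, h4]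

theorem edist_projPoint_le (hp : IsCoveringMap p) (hF : IsEquivariant ρ F)
    (x y : FacePoint (liftF T p) (upLength F)) :
    edist (projPoint hp hF x) (projPoint hp hF y) ≤ edist x y :=
  edist_map_le (projPoint hp hF) (fun _ => rfl) (fun _ _ h => congrArg projFace h)
    (fun _ _ h => glued_projPoint hp hF h) x y

/-- The projection of the lifted structure to the structure on the surface. -/
def projCone (hp : IsCoveringMap p) (hF : IsEquivariant ρ F) : ConeFLift F → ConeF F :=
  SeparationQuotient.lift (fun x => Cone.mk (projPoint hp hF x)) fun x y h =>
    edist_le_zero.1 ((edist_projPoint_le hp hF x y).trans_eq (EMetric.inseparable_iff.1 h))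

theorem projCone_mk (hp : IsCoveringMap p) (hF : IsEquivariant ρ F)
    (x : FacePoint (liftF T p) (upLength F)) :
    projCone hp hF (Cone.mk x) = Cone.mk (projPoint hp hF x) := rfl

theorem exists_lift_facePoint (hp : IsCoveringMap p) (hF : IsEquivariant ρ F) (g : liftF T p)
    (y : FacePoint T.F (downLength F)) (h : projFace g = y.face) :
    ∃ x : FacePoint (liftF T p) (upLength F), x.face = g ∧ projPoint hp hF x = y :=
  ⟨⟨g, y.pt, by rw [← downLength_projFace hp hF, h]; exact y.mem⟩, rfl, FacePoint.ext_of h rfl⟩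

/-- Chains can be lifted. -/
theorem exists_lift_chain (hp : IsCoveringMap p) (hF : IsEquivariant ρ F)
    (x : FacePoint (liftF T p) (upLength F)) {y : FacePoint T.F (downLength F)} {L : ℝ≥0∞}
    (h : Chain (projPoint hp hF x) y L) : ∃ y', projPoint hp hF y' = y ∧ Chain x y' L := by
  induction h with
  | refl => exact ⟨x, rfl, Chain.refl⟩
  | @move y z L _ hf ih =>
    obtain ⟨y', rfl, hc⟩ := ih
    obtain ⟨z', hz', rfl⟩ := exists_lift_facePoint hp hF y'.face z hf
    exact ⟨z', rfl, hc.move hz'.symm⟩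
  | @glue y z L _ hg ih =>
    obtain ⟨y', rfl, hc⟩ := ih
    obtain ⟨i, j, k, l, h1, h2, h3, h4⟩ := hg
    obtain ⟨g, hg, hs⟩ := exists_liftFace_side_eq hp y'.face z.face h1
    obtain ⟨z', rfl, rfl⟩ := exists_lift_facePoint hp hF g z hg
    rw [dist_projPoint, dist_projPoint] at h4
    exact ⟨z', rfl, hc.glue ⟨i, j, k, l, hs, (onSide_projPoint hp hF).1 h2,
      (onSide_projPoint hp hF).1 h3, h4⟩⟩

theorem projPoint_deckPoint (hp : IsCoveringMap p) (hF : IsEquivariant ρ F) (γ : deckGroup p)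
    (x : FacePoint (liftF T p) (upLength F)) :
    projPoint hp hF (deckPoint hF γ x) = projPoint hp hF x :=
  FacePoint.ext_of (Subtype.ext (ContinuousMap.ext fun t => γ.2 (x.face.1 t))) rfl

/-- The projection is short and invariant, which gives one inequality. For the other, a nearly
optimal chain below lifts from `y` with the same length, and its end is a translate of `z`. -/
theorem edist_projCone (hp : IsCoveringMap p) (hF : IsEquivariant ρ F) (y z : ConeFLift F) :
    edist (projCone hp hF y) (projCone hp hF z) = ⨅ γ : deckGroup p, edist y (coneRep hF γ z) := by
  obtain ⟨y, rfl⟩ := SeparationQuotient.surjective_mk y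
  obtain ⟨z, rfl⟩ := SeparationQuotient.surjective_mk z
  apply le_antisymm
  · refine le_iInf fun γ => ?_
    have := edist_projPoint_le hp hF y (deckPoint hF γ z)
    rw [projPoint_deckPoint] at this
    exact this
  · refine le_of_forall_gt fun r hr => ?_
    obtain ⟨L, hL, hc⟩ := exists_chain_of_edist_lt hr
    obtain ⟨z', hz', hc'⟩ := exists_lift_chain hp hF y hc
    obtain ⟨γ, hγ⟩ := exists_deckFace_eq hp (g := z.face) (g' := z'.face)
      (congrArg FacePoint.face hz').symm
    have e : deckPoint hF γ z = z' :=
      FacePoint.ext_of hγ (congrArg FacePoint.pt hz').symm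
    refine lt_of_le_of_lt (iInf_le _ γ) (lt_of_le_of_lt ?_ hL)
    rw [← e] at hc'
    exact edist_mk_le_of_chain hc'

end Projection

end

/-! ### Assembly of the two structures and the covering -/

theorem mainTheorem4
    {S : Type*} [TopologicalSpace S] [T2Space S] [CompactSpace S] [ConnectedSpace S]
    [ChartedSpace (EuclideanSpace ℝ (Fin 2)) S]
    {S' : Type*} [TopologicalSpace S'] [SimplyConnectedSpace S']
    (p : C(S', S)) (hp : IsCoveringMap p)
    {X : Type*} [MetricSpace X] [CompleteSpace X] (hX : IsCATNegOne X)
    (ρ : deckGroup p →* (X ≃ᵢ X))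
    (T : Triangulation S) (F : liftV T p → X) (hF : IsEquivariant ρ F) :
    -- `ρ_F` dominates `ρ`, by a map which extends `F` by the comparison map of each face
    (∃ f : ConeFLift F → X, IsDomination (coneRep hF) ρ f ∧
      ∀ (x : FacePoint (liftF T p) (upLength F)) (i j : Fin 3), x.OnSide i j →
        dist (F (liftVertex x.face i)) (f (Cone.mk x)) =
            dist (triangleOfLengths (upLength F x.face) i) x.pt ∧
          dist (f (Cone.mk x)) (F (liftVertex x.face j)) =
            dist x.pt (triangleOfLengths (upLength F x.face) j)) ∧
    -- distances in the space on which `ρ_F` acts are finite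
    (∀ y z : ConeFLift F, edist y z ≠ ⊤) ∧
    -- relation of `ρ_F` with `C_F` and the maps `pT : S → C_F`, `pT' : S' → ConeFLift F`
    ∃ (pT : C(S, ConeF F)) (pT' : C(S', ConeFLift F)) (π : ConeFLift F → ConeF F),
      Function.Surjective pT ∧ Function.Surjective pT' ∧ RespectsFaces pT ∧ RespectsFaces pT' ∧
      (∀ s, π (pT' s) = pT (p s)) ∧
      (∀ (γ : deckGroup p) s, pT' (γ.1 s) = coneRep hF γ (pT' s)) ∧
      -- `π` maps `Δ_g` identically onto `Δ_{p ∘ g}`, and `C_F` is the quotient by the action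
      (∀ (x : FacePoint (liftF T p) (upLength F)) (y : FacePoint T.F (downLength F)),
        y.face.1 = p.comp x.face.1 → y.pt = x.pt → π (Cone.mk x) = Cone.mk y) ∧
      (∀ y z, edist (π y) (π z) = ⨅ γ : deckGroup p, edist y (coneRep hF γ z)) ∧
      -- if no face is flattened, `π` is the universal covering of `C_F`
      (NonDegenerate (upLength F) →
        IsHomeomorph pT ∧ IsHomeomorph pT' ∧ IsCoveringMap π ∧
        SimplyConnectedSpace (ConeFLift F) ∧
        ∀ y, ∃ r > 0, ∀ z w, edist z y < r → edist w y < r → edist (π z) (π w) = edist z w) := by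
  have : LocallyPathConnectedSpace S :=
    ChartedSpace.locallyPathConnectedSpace (EuclideanSpace ℝ (Fin 2)) S
  have : PathConnectedSpace S := pathConnectedSpace_iff_connectedSpace.2 inferInstance
  have : LocallyPathConnectedSpace S' := hp.isLocalHomeomorph.locallyPathConnectedSpace
  have : T2Space S' := hp.t2Space
  have hsurj : Function.Surjective p := hp.surjective_of_pathConnected
  have hT := T.isFaceSystem
  have hT' := isFaceSystem_liftF hp T
  have hℓ := isLengthFunction_downLength hp hsurj hF
  have hℓ' := isLengthFunction_upLength F
  set P : S → ConeF F := hT.toCone (downLength F) with hP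
  set P' : S' → ConeFLift F := hT'.toCone (upLength F) with hP'
  have hPc : Continuous P := hT.continuous_toCone hℓ
  have hPc' : Continuous P' := hT'.continuous_toCone hℓ'
  have hPs : Function.Surjective P := hT.surjective_toCone hℓ
  have hPs' : Function.Surjective P' := hT'.surjective_toCone hℓ'
  have hπ : ∀ s, projCone hp hF (P' s) = P (p s) := by
    intro s
    obtain ⟨⟨g, t⟩, rfl⟩ := hT'.cover s
    change _ = P ((projFace g).1 t)
    rw [hP, hP', hT'.toCone_apply hℓ', hT.toCone_apply hℓ, projCone_mk]
    congr 1
    refine FacePoint.ext_of rfl ?_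
    change bary (triangleOfLengths (upLength F g)) t =
      bary (triangleOfLengths (downLength F (projFace g))) t
    rw [downLength_projFace hp hF]
  have hequiv : ∀ (γ : deckGroup p) s, P' (γ.1 s) = coneRep hF γ (P' s) := by
    intro γ s
    obtain ⟨⟨g, t⟩, rfl⟩ := hT'.cover s
    change P' ((deckFace γ g).1 t) = _
    rw [hP', hT'.toCone_apply hℓ', hT'.toCone_apply hℓ']
    change _ = Cone.mk (deckPoint hF γ (facePt (upLength F) g t))
    congr 1
    refine FacePoint.ext_of rfl ?_
    change bary (triangleOfLengths (upLength F (deckFace γ g))) t =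
      bary (triangleOfLengths (upLength F g)) t
    rw [upLength_deckFace hF]
  refine ⟨exists_isDomination hp hsurj hX hF, edist_ne_top_of_preconnected hPc' hPs',
    ⟨P, hPc⟩, ⟨P', hPc'⟩, projCone hp hF, hPs, hPs', hT.respectsFaces_toCone hℓ,
    hT'.respectsFaces_toCone hℓ', hπ, hequiv, fun x y h1 h2 => ?_, edist_projCone hp hF,
    fun hnd => ?_⟩
  · rw [projCone_mk]
    congr 1
    exact FacePoint.ext_of (Subtype.ext h1.symm) h2.symm
  · have hh : IsHomeomorph P :=
      hT.isHomeomorph_toCone hℓ (nonDegenerate_downLength hp hsurj hF hnd)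
    have hh' : IsHomeomorph P' := hT'.isHomeomorph_toCone hℓ' hnd
    refine ⟨hh, hh', ?_, hh'.homeomorph.symm.toHomotopyEquiv.simplyConnectedSpace, fun y => ?_⟩
    · have h1 : projCone hp hF = hh.homeomorph ∘ p ∘ hh'.homeomorph.symm := by
        funext c
        obtain ⟨s, rfl⟩ := hPs' c
        rw [hπ]
        have h2 : hh'.homeomorph.symm (P' s) = s := hh'.homeomorph.symm_apply_apply s
        change _ = P (p (hh'.homeomorph.symm (P' s)))
        rw [h2]
      rw [h1]
      exact (hp.comp_homeomorph _).homeomorph_comp _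
    · obtain ⟨s, rfl⟩ := hPs' y
      obtain ⟨U, hU, hsU, hinj⟩ := hp.exists_injOn_nhds s
      obtain ⟨ε, hε, hεU⟩ := EMetric.mem_nhds_iff.1
        ((hh'.isOpenMap U hU).mem_nhds (Set.mem_image_of_mem P' hsU))
      -- The sheet `U` contains only one point of the orbit of `s`, and its image contains the
      -- `ε`-ball about `P' s`.
      have hsep : ∀ γ : deckGroup p, γ ≠ 1 → ε ≤ edist (P' s) (coneRep hF γ (P' s)) := by
        intro γ hγ
        by_contra! hlt
        obtain ⟨u, hu, hus⟩ := hεU (show coneRep hF γ (P' s) ∈ Metric.eball (P' s) ε by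
          rw [Metric.mem_eball, edist_comm]; exact hlt)
        rw [← hequiv] at hus
        have h1 : u = γ.1 s := hh'.injective hus
        refine hγ (deckGroup_eq_one hp (s := s) (hinj (h1 ▸ hu) hsU (γ.2 s)))
      -- The minimum with `1` keeps the radius finite when `ε = ⊤`. The factor `4` serves the final
      -- estimate: `z` and `w` are within `2r` of each other, while nontrivial translates of `w` are
      -- at least `ε - 2r ≥ 2r` from `z`, so the identity attains the infimum.
      have hr0 : min ε 1 / 4 ≠ 0 := by
        rw [Ne, ENNReal.div_eq_zero_iff, not_or]
        exact ⟨(lt_min hε one_pos).ne', by simp⟩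
      have hrt : min ε 1 / 4 ≠ ⊤ :=
        ne_of_lt (ENNReal.div_lt_top (ne_of_lt ((min_le_right _ _).trans_lt ENNReal.one_lt_top))
          (by simp))
      have hr4 : min ε 1 / 4 + min ε 1 / 4 + (min ε 1 / 4 + min ε 1 / 4) ≤ ε := by
        have : min ε 1 / 4 + min ε 1 / 4 + (min ε 1 / 4 + min ε 1 / 4) = 4 * (min ε 1 / 4) := by
          ring
        rw [this, ENNReal.mul_div_cancel (by simp) (by simp)]
        exact min_le_left _ _
      generalize min ε 1 / 4 = r at hr0 hrt hr4
      refine ⟨r, pos_iff_ne_zero.2 hr0, fun z w hz hw => ?_⟩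
      rw [edist_projCone]
      refine le_antisymm ((iInf_le _ 1).trans_eq (by rw [map_one]; rfl)) (le_iInf fun γ => ?_)
      by_cases hγ : γ = 1
      · rw [hγ, map_one]
        rfl
      have h1 : edist z w ≤ r + r := (edist_triangle_right z w (P' s)).trans (add_le_add hz.le hw.le)
      have h2 : edist (P' s) (coneRep hF γ (P' s)) ≤ (r + r) + edist z (coneRep hF γ w) := by
        calc _ ≤ edist (P' s) z + edist z (coneRep hF γ w) +
              edist (coneRep hF γ w) (coneRep hF γ (P' s)) := edist_triangle4 _ _ _ _
          _ ≤ r + edist z (coneRep hF γ w) + r := by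
              rw [(coneRep hF γ).edist_eq, edist_comm (P' s)]
              gcongr
          _ = _ := by ring
      exact h1.trans ((ENNReal.add_le_add_iff_left (by simp [hrt])).1
        ((hr4.trans (hsep γ hγ)).trans h2))
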